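/- Let $k$ be a field. All bimodules are assumed to be $k$-central ($\lambda m = m\lambda$ for $\lambda\in k$). An $(S,S)$-bimodule $V$ over a $k$-algebra $S$ is *invertible* if there is an $(S,S)$-bimodule $W$ with $V\otimes_S W\cong S\cong W\otimes_S V$ as bimodules. For an $\mathbb{N}$-graded $k$-algebra $A=\bigoplus_{n\ge 0}A_n$, let $J(A)$ be its graded Jacobson radical (the intersection of the maximal homogeneous left ideals). If $A$ is locally finite (each $A_n$ is finite-dimensional over $k$), then $A$ is called *generalized AS regular of dimension $d$* if its graded global dimension (the supremum, over all $\mathbb{Z}$-graded left $A$-modules $M$, of the minimal length of a graded projective resolution of $M$) is equal to $d$ and, with $\bar S=A/J(A)$, there is an invertible $(\bar S,\bar S)$-bimodule $U$ such that $\operatorname{Ext}^i_A(\bar S,A)=0$ for $i\neq d$ and $\operatorname{Ext}^d_A(\bar S,A)\cong U$ as $(\bar S,\bar S)$-bimodules. (Here Ext is taken over left $A$-modules; $\bar S$ acts on the left of $\operatorname{Ext}^d_A(\bar S,A)$ through right multiplication on $\bar S$, and $A$ acts on the right through right multiplication on $A$; the isomorphism is one of $(\bar S,A)$-bimodules, where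 $A$ acts on $U$ through $A\to\bar S$.) **Theorem.** Let $S$ be a finite-dimensional semisimple $k$-algebra, and let $V=\bigoplus_{n\ge 0}V_n$ be a nonzero, nonnegatively graded, finite-dimensional $(S,S)$-bimodule, where $S$ is placed in degree $0$. Let $A=T_S(V)=\bigoplus_{r\ge 0}V^{\otimes_S r}$ be the tensor algebra, graded so that $S$ has degree $0$ and a tensor $v_1\otimes\cdots\otimes v_r$ of homogeneous elements has degree $\deg v_1+\cdots+\deg v_r$, and suppose that $A$ is locally finite. Then, for every integer $d\ge 0$, the algebra $A$ is generalized AS regular of dimension $d$ if and only if $V$ is an invertible bimodule and $d=1$. -/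

import Mathlib

open CategoryTheory
open scoped TensorProduct DirectSum

universe u

/-! ### Central bimodules, balanced tensor products, invertible bimodules

An `(S, S)`-bimodule is a type `V` with a left `S`-action, a right `S`-action (written as an action
of `Sᵐᵒᵖ`) that commutes with it, and a `k`-structure through which both actions are `k`-linear;
so it is `k`-central: `(algebraMap k S c) • v = c • v = v • (algebraMap k S c)`. -/

/-- A bundled `k`-central `(S, S)`-bimodule. -/
structure CentralBimodule (k S : Type u) [Field k] [Ring S] [Algebra k S] where
  carrier : Type u
  [addCommGroup : AddCommGroup carrier]
  [modk : Module k carrier]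
  [modl : Module S carrier]
  [modr : Module Sᵐᵒᵖ carrier]
  [comm : SMulCommClass S Sᵐᵒᵖ carrier]
  [towl : IsScalarTower k S carrier]
  [towr : IsScalarTower k Sᵐᵒᵖ carrier]

attribute [instance] CentralBimodule.addCommGroup CentralBimodule.modk CentralBimodule.modl
  CentralBimodule.modr CentralBimodule.comm CentralBimodule.towl CentralBimodule.towr

section Balanced

variable (k S : Type u) [Field k] [Ring S] [Algebra k S]
variable (V W : Type u) [AddCommGroup V] [Module k V] [Module Sᵐᵒᵖ V]
  [AddCommGroup W] [Module k W] [Module S W]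

/-- The subspace of `V ⊗[k] W` spanned by the elements `(v s) ⊗ w - v ⊗ (s w)`. -/
def balancedRelations : Submodule k (V ⊗[k] W) :=
  Submodule.span k {x | ∃ (v : V) (s : S) (w : W),
    x = (MulOpposite.op s • v) ⊗ₜ[k] w - v ⊗ₜ[k] (s • w)}

/-- The tensor product `V ⊗_S W` of a right and a left `S`-module. -/
abbrev BalancedTensor : Type u := (V ⊗[k] W) ⧸ balancedRelations k S V W

variable {V W}

/-- The element `v ⊗ w` of `V ⊗_S W`. -/
def balancedTmul (v : V) (w : W) : BalancedTensor k S V W :=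
  (balancedRelations k S V W).mkQ (v ⊗ₜ[k] w)

end Balanced

/-- `V ⊗_S W ≅ S` as `(S, S)`-bimodules. The action of `(s, t)` on `V ⊗_S W` is
`s (v ⊗ w) t = (s v) ⊗ (w t)`, and the elements `v ⊗ w` generate `V ⊗_S W` additively. -/
def BalancedTensorIsoRing (k S : Type u) [Field k] [Ring S] [Algebra k S]
    (V W : Type u) [AddCommGroup V] [Module k V] [Module S V] [Module Sᵐᵒᵖ V]
    [AddCommGroup W] [Module k W] [Module S W] [Module Sᵐᵒᵖ W] : Prop :=
  ∃ e : BalancedTensor k S V W ≃+ S, ∀ (s t : S) (v : V) (w : W),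
    e (balancedTmul k S (s • v) (MulOpposite.op t • w)) = s * e (balancedTmul k S v w) * t

/-- A `k`-central `(S, S)`-bimodule `V` is invertible if there is a `k`-central `(S, S)`-bimodule
`W` with `V ⊗_S W ≅ S ≅ W ⊗_S V` as bimodules. -/
def IsInvertibleBimodule (k S V : Type u) [Field k] [Ring S] [Algebra k S]
    [AddCommGroup V] [Module k V] [Module S V] [Module Sᵐᵒᵖ V] : Prop :=
  ∃ W : CentralBimodule k S,
    BalancedTensorIsoRing k S V W.carrier ∧ BalancedTensorIsoRing k S W.carrier V

/-! ### The tensor algebra `T_S(V)` of a bimodule -/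

section TensorAlg

variable (k S V : Type u) [Field k] [Ring S] [Algebra k S]
  [AddCommGroup V] [Module k V] [Module S V] [Module Sᵐᵒᵖ V]

/-- The relations in the free `k`-algebra on the vector space `S × V` which say that `S` maps to
the quotient by a ring homomorphism and `V` by a bimodule homomorphism. -/
inductive BimoduleTensorAlgebra.Rel : TensorAlgebra k (S × V) → TensorAlgebra k (S × V) → Prop
  | one : Rel (TensorAlgebra.ι k (1, 0)) 1
  | mul (s t : S) :
      Rel (TensorAlgebra.ι k (s * t, 0)) (TensorAlgebra.ι k (s, 0) * TensorAlgebra.ι k (t, 0))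
  | left (s : S) (v : V) :
      Rel (TensorAlgebra.ι k (0, s • v)) (TensorAlgebra.ι k (s, 0) * TensorAlgebra.ι k (0, v))
  | right (s : S) (v : V) :
      Rel (TensorAlgebra.ι k (0, MulOpposite.op s • v))
        (TensorAlgebra.ι k (0, v) * TensorAlgebra.ι k (s, 0))

/-- The tensor algebra `T_S(V)`, that is `⨁ n, V ⊗_S ⋯ ⊗_S V` (`n` factors, `S` for `n = 0`): the
universal `k`-algebra with an algebra map from `S` and a bimodule map from `V`
(see `BimoduleTensorAlgebra.lift` and `BimoduleTensorAlgebra.hom_ext` below). -/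
def BimoduleTensorAlgebra : Type u := RingQuot (BimoduleTensorAlgebra.Rel k S V)

namespace BimoduleTensorAlgebra

noncomputable instance : Ring (BimoduleTensorAlgebra k S V) :=
  inferInstanceAs (Ring (RingQuot (Rel k S V)))

noncomputable instance : Algebra k (BimoduleTensorAlgebra k S V) :=
  inferInstanceAs (Algebra k (RingQuot (Rel k S V)))

/-- The quotient map from the free algebra on `S × V`. -/
noncomputable def mk : TensorAlgebra k (S × V) →ₐ[k] BimoduleTensorAlgebra k S V :=
  RingQuot.mkAlgHom k (Rel k S V)

theorem mk_rel {x y : TensorAlgebra k (S × V)} (h : Rel k S V x y) :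
    mk k S V x = mk k S V y :=
  RingQuot.mkAlgHom_rel k h

/-- The inclusion of the algebra `S` into `T_S(V)`. -/
noncomputable def ofRing : S →ₐ[k] BimoduleTensorAlgebra k S V :=
  AlgHom.ofLinearMap ((mk k S V).toLinearMap ∘ₗ TensorAlgebra.ι k ∘ₗ LinearMap.inl k S V)
    (by simpa using mk_rel k S V Rel.one)
    (fun s t => by simpa using mk_rel k S V (Rel.mul s t))

/-- The inclusion of `V` into `T_S(V)`. -/
noncomputable def ofBimodule : V →ₗ[k] BimoduleTensorAlgebra k S V :=
  (mk k S V).toLinearMap ∘ₗ TensorAlgebra.ι k ∘ₗ LinearMap.inr k S V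

theorem ofBimodule_smul (s : S) (v : V) :
    ofBimodule k S V (s • v) = ofRing k S V s * ofBimodule k S V v := by
  simpa [ofBimodule, ofRing] using mk_rel k S V (Rel.left s v)

theorem ofBimodule_op_smul (s : S) (v : V) :
    ofBimodule k S V (MulOpposite.op s • v) = ofBimodule k S V v * ofRing k S V s := by
  simpa [ofBimodule, ofRing] using mk_rel k S V (Rel.right s v)

variable {k S V}

/-- Universal property of `T_S(V)`: existence. -/
noncomputable def lift {B : Type*} [Semiring B] [Algebra k B] (f : S →ₐ[k] B) (g : V →ₗ[k] B)
    (hl : ∀ (s : S) (v : V), g (s • v) = f s * g v)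
    (hr : ∀ (s : S) (v : V), g (MulOpposite.op s • v) = g v * f s) :
    BimoduleTensorAlgebra k S V →ₐ[k] B :=
  RingQuot.liftAlgHom k ⟨TensorAlgebra.lift k (f.toLinearMap.coprod g), by
    intro x y h
    cases h with
    | one => simp
    | mul s t => simp
    | left s v => simp [hl]
    | right s v => simp [hr]⟩

section lift

variable {B : Type*} [Semiring B] [Algebra k B] (f : S →ₐ[k] B) (g : V →ₗ[k] B)
    (hl : ∀ (s : S) (v : V), g (s • v) = f s * g v)
    (hr : ∀ (s : S) (v : V), g (MulOpposite.op s • v) = g v * f s)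

theorem lift_mk (x : TensorAlgebra k (S × V)) :
    lift f g hl hr (mk k S V x) = TensorAlgebra.lift k (f.toLinearMap.coprod g) x :=
  RingQuot.liftAlgHom_mkAlgHom_apply k _ _ x

@[simp] theorem lift_ofRing (s : S) : lift f g hl hr (ofRing k S V s) = f s := by
  have h := lift_mk f g hl hr (TensorAlgebra.ι k (s, 0))
  simpa [ofRing] using h

@[simp] theorem lift_ofBimodule (v : V) : lift f g hl hr (ofBimodule k S V v) = g v := by
  have h := lift_mk f g hl hr (TensorAlgebra.ι k (0, v))
  simpa [ofBimodule] using h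

end lift

/-- Universal property of `T_S(V)`: uniqueness. -/
theorem hom_ext {B : Type*} [Semiring B] [Algebra k B] {φ ψ : BimoduleTensorAlgebra k S V →ₐ[k] B}
    (h₁ : ∀ s, φ (ofRing k S V s) = ψ (ofRing k S V s))
    (h₂ : ∀ v, φ (ofBimodule k S V v) = ψ (ofBimodule k S V v)) : φ = ψ := by
  refine RingQuot.ringQuot_ext' k φ ψ ?_
  refine TensorAlgebra.hom_ext ?_
  refine LinearMap.prod_ext ?_ ?_
  · ext s; exact h₁ s
  · ext v; exact h₂ v

end BimoduleTensorAlgebra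

end TensorAlg

/-- A nonnegative grading `V = ⨁ n, 𝒱 n` of a vector space (`DirectSum.Decomposition 𝒱`) is a
grading of the `(S, S)`-bimodule `V`, with `S` in degree `0`, if each `𝒱 n` is a sub-bimodule. -/
class IsGradedBimodule {k S V : Type u} [Field k] [Ring S] [Algebra k S]
    [AddCommGroup V] [Module k V] [Module S V] [Module Sᵐᵒᵖ V] (𝒱 : ℕ → Submodule k V) : Prop where
  smul_mem : ∀ (n : ℕ) (s : S) (v : V), v ∈ 𝒱 n → s • v ∈ 𝒱 n
  op_smul_mem : ∀ (n : ℕ) (s : S) (v : V), v ∈ 𝒱 n → MulOpposite.op s • v ∈ 𝒱 n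

namespace BimoduleTensorAlgebra

section Grading

variable {k V : Type u} (S : Type u) [Field k] [Ring S] [Algebra k S]
  [AddCommGroup V] [Module k V] [Module S V] [Module Sᵐᵒᵖ V] (𝒱 : ℕ → Submodule k V)

/-- `IsMonomial S 𝒱 n x`: `x` is a product of elements of `S` and homogeneous elements of `V`
whose degrees add up to `n`. -/
inductive IsMonomial : ℕ → BimoduleTensorAlgebra k S V → Prop
  | ofRing (s : S) : IsMonomial 0 (ofRing k S V s)
  | ofBimodule (n : ℕ) (v : V) (hv : v ∈ 𝒱 n) : IsMonomial n (ofBimodule k S V v)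
  | mul (m n : ℕ) (x y : BimoduleTensorAlgebra k S V) (hx : IsMonomial m x)
      (hy : IsMonomial n y) : IsMonomial (m + n) (x * y)

/-- The grading of `T_S(V)` induced by the grading of `V`, with
`deg (v₁ ⊗ ⋯ ⊗ vᵣ) = deg v₁ + ⋯ + deg vᵣ` and `S` in degree `0`. -/
noncomputable def grading (n : ℕ) : Submodule k (BimoduleTensorAlgebra k S V) :=
  Submodule.span k {x | IsMonomial S 𝒱 n x}

instance grading_gradedMonoid : SetLike.GradedMonoid (grading S 𝒱) where
  one_mem := by
    refine Submodule.subset_span ?_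
    have h := IsMonomial.ofRing (𝒱 := 𝒱) (1 : S)
    rwa [map_one] at h
  mul_mem := by
    intro m n x y hx hy
    have h : x * y ∈ grading S 𝒱 m * grading S 𝒱 n := Submodule.mul_mem_mul hx hy
    unfold grading at h
    rw [Submodule.span_mul_span] at h
    refine Submodule.span_mono ?_ h
    rintro _ ⟨a, ha, b, hb, rfl⟩
    exact IsMonomial.mul m n a b ha hb


/-- The inclusion of `S` into `⨁ n, T_S(V)_n`. -/
noncomputable def gradedOfRing : S →ₐ[k] ⨁ n, grading S 𝒱 n :=
  AlgHom.ofLinearMap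
    ((DirectSum.lof k ℕ (fun n => grading S 𝒱 n) 0) ∘ₗ
      ((ofRing k S V).toLinearMap.codRestrict (grading S 𝒱 0)
        fun s => Submodule.subset_span (IsMonomial.ofRing s)))
    (by
      rw [LinearMap.comp_apply, DirectSum.lof_eq_of, DirectSum.one_def]
      congr 1
      exact Subtype.ext (map_one (ofRing k S V)))
    (by
      intro s t
      simp only [LinearMap.comp_apply, DirectSum.lof_eq_of, DirectSum.of_mul_of]
      refine DirectSum.of_eq_of_gradedMonoid_eq ?_
      exact Sigma.subtype_ext (zero_add 0).symm (map_mul (ofRing k S V) s t))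

theorem gradedOfRing_apply (s : S) : gradedOfRing S 𝒱 s =
    DirectSum.of (fun n => grading S 𝒱 n) 0 ⟨ofRing k S V s,
      Submodule.subset_span (IsMonomial.ofRing s)⟩ := rfl

/-- The inclusion of `V_n` into `T_S(V)_n`. -/
noncomputable def gradedOfPiece (n : ℕ) : 𝒱 n →ₗ[k] grading S 𝒱 n :=
  ((ofBimodule k S V) ∘ₗ (𝒱 n).subtype).codRestrict (grading S 𝒱 n)
    fun v => Submodule.subset_span (IsMonomial.ofBimodule n (v : V) v.2)

variable [DirectSum.Decomposition 𝒱]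

/-- The inclusion of `V` into `⨁ n, T_S(V)_n`. -/
noncomputable def gradedOfBimodule : V →ₗ[k] ⨁ n, grading S 𝒱 n :=
  (DirectSum.toModule k ℕ (⨁ n, grading S 𝒱 n) fun n =>
      (DirectSum.lof k ℕ (fun n => grading S 𝒱 n) n) ∘ₗ gradedOfPiece S 𝒱 n) ∘ₗ
    (DirectSum.decomposeLinearEquiv 𝒱).toLinearMap

theorem gradedOfBimodule_of_mem {n : ℕ} (v : V) (hv : v ∈ 𝒱 n) :
    gradedOfBimodule S 𝒱 v =
      DirectSum.of (fun n => grading S 𝒱 n) n ⟨ofBimodule k S V v,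
        Submodule.subset_span (IsMonomial.ofBimodule n v hv)⟩ := by
  simp only [gradedOfBimodule, LinearMap.comp_apply, LinearEquiv.coe_coe,
    DirectSum.decomposeLinearEquiv_apply, DirectSum.decompose_of_mem 𝒱 hv]
  rw [← DirectSum.lof_eq_of k, DirectSum.toModule_lof, LinearMap.comp_apply]
  rfl

theorem gradedOfBimodule_smul [IsGradedBimodule (S := S) 𝒱] (s : S) (v : V) :
    gradedOfBimodule S 𝒱 (s • v) = gradedOfRing S 𝒱 s * gradedOfBimodule S 𝒱 v := by
  induction v using DirectSum.Decomposition.inductionOn 𝒱 with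
  | zero => simp
  | add x y hx hy => rw [smul_add, map_add, map_add, mul_add, hx, hy]
  | @homogeneous n v =>
    rw [gradedOfBimodule_of_mem S 𝒱 (v : V) v.2,
      gradedOfBimodule_of_mem S 𝒱 (s • (v : V)) (IsGradedBimodule.smul_mem n s _ v.2)]
    rw [gradedOfRing_apply, DirectSum.of_mul_of]
    refine DirectSum.of_eq_of_gradedMonoid_eq ?_
    exact Sigma.subtype_ext (zero_add n).symm (ofBimodule_smul k S V s v)

theorem gradedOfBimodule_op_smul [IsGradedBimodule (S := S) 𝒱] (s : S) (v : V) :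
    gradedOfBimodule S 𝒱 (MulOpposite.op s • v) =
      gradedOfBimodule S 𝒱 v * gradedOfRing S 𝒱 s := by
  induction v using DirectSum.Decomposition.inductionOn 𝒱 with
  | zero => simp
  | add x y hx hy => rw [smul_add, map_add, map_add, add_mul, hx, hy]
  | @homogeneous n v =>
    rw [gradedOfBimodule_of_mem S 𝒱 (v : V) v.2,
      gradedOfBimodule_of_mem S 𝒱 (MulOpposite.op s • (v : V))
        (IsGradedBimodule.op_smul_mem n s _ v.2)]
    rw [gradedOfRing_apply, DirectSum.of_mul_of]
    refine DirectSum.of_eq_of_gradedMonoid_eq ?_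
    exact Sigma.subtype_ext (add_zero n).symm (ofBimodule_op_smul k S V s v)

/-- The decomposition map `T_S(V) → ⨁ n, T_S(V)_n`. -/
noncomputable def toGraded [IsGradedBimodule (S := S) 𝒱] :
    BimoduleTensorAlgebra k S V →ₐ[k] ⨁ n, grading S 𝒱 n :=
  lift (gradedOfRing S 𝒱) (gradedOfBimodule S 𝒱) (gradedOfBimodule_smul S 𝒱)
    (gradedOfBimodule_op_smul S 𝒱)

theorem toGraded_of_isMonomial [IsGradedBimodule (S := S) 𝒱] {n : ℕ}
    {x : BimoduleTensorAlgebra k S V} (h : IsMonomial S 𝒱 n x) :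
    toGraded S 𝒱 x =
      DirectSum.of (fun n => grading S 𝒱 n) n ⟨x, Submodule.subset_span h⟩ := by
  induction h with
  | ofRing s => exact lift_ofRing _ _ _ _ s
  | ofBimodule n v hv =>
    exact (lift_ofBimodule _ _ _ _ v).trans (gradedOfBimodule_of_mem S 𝒱 v hv)
  | mul m n x y hx hy ihx ihy =>
    rw [map_mul, ihx, ihy, DirectSum.of_mul_of]
    rfl

/-- `T_S(V)` is the direct sum of its homogeneous components. -/
noncomputable instance [IsGradedBimodule (S := S) 𝒱] : GradedAlgebra (grading S 𝒱) :=
  GradedAlgebra.ofAlgHom (grading S 𝒱) (toGraded S 𝒱)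
    (by
      refine hom_ext (fun s => ?_) (fun v => ?_)
      · rw [AlgHom.comp_apply, toGraded_of_isMonomial S 𝒱 (IsMonomial.ofRing s),
          DirectSum.coeAlgHom_of]
        rfl
      · rw [AlgHom.comp_apply]
        induction v using DirectSum.Decomposition.inductionOn 𝒱 with
        | zero => simp
        | add x y hx hy => simp only [map_add, hx, hy]
        | @homogeneous n v =>
          rw [toGraded_of_isMonomial S 𝒱 (IsMonomial.ofBimodule n (v : V) v.2),
            DirectSum.coeAlgHom_of]
          rfl)
    (by
      rintro n ⟨x, hx⟩
      change toGraded S 𝒱 x = _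
      induction hx using Submodule.span_induction with
      | mem y hy => exact toGraded_of_isMonomial S 𝒱 hy
      | zero => rw [map_zero]; exact (map_zero _).symm
      | add y z hy hz ihy ihz => rw [map_add, ihy, ihz, ← map_add]; rfl
      | smul c y hy ih =>
        rw [map_smul, ih, ← DirectSum.lof_eq_of k, ← map_smul]; rfl)

end Grading
end BimoduleTensorAlgebra

/-! ### Graded modules and the graded global dimension -/

section GradedModules

variable {k A : Type u} [Field k] [Ring A] [Algebra k A]

/-- A `ℤ`-graded left module over the `ℕ`-graded algebra `A = ⨁ n, 𝒜 n`. -/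
structure GrMod (𝒜 : ℕ → Submodule k A) where
  carrier : Type u
  [addCommGroup : AddCommGroup carrier]
  [module : Module A carrier]
  /-- the homogeneous components -/
  piece : ℤ → AddSubgroup carrier
  isInternal : DirectSum.IsInternal piece
  smul_mem : ∀ (i : ℕ) (j : ℤ) (a : A) (m : carrier),
    a ∈ 𝒜 i → m ∈ piece j → a • m ∈ piece ((i : ℤ) + j)

attribute [instance] GrMod.addCommGroup GrMod.module

variable {𝒜 : ℕ → Submodule k A}

/-- The `A`-linear map `f` preserves degrees. -/
def IsGradedHom {M N : GrMod 𝒜} (f : M.carrier →ₗ[A] N.carrier) : Prop :=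
  ∀ (j : ℤ) (m : M.carrier), m ∈ M.piece j → f m ∈ N.piece j

/-- `P` is a projective object of the category of graded left `A`-modules (with the
degree-preserving homomorphisms). -/
def IsGradedProjective (P : GrMod 𝒜) : Prop :=
  ∀ (M N : GrMod 𝒜) (g : M.carrier →ₗ[A] N.carrier) (f : P.carrier →ₗ[A] N.carrier),
    IsGradedHom g → IsGradedHom f → Function.Surjective g →
      ∃ h : P.carrier →ₗ[A] M.carrier, IsGradedHom h ∧ g ∘ₗ h = f

/-- A graded projective resolution `⋯ → P 1 → P 0 → M → 0`. -/
structure GradedProjectiveResolution (M : GrMod 𝒜) where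
  P : ℕ → GrMod 𝒜
  projective : ∀ i, IsGradedProjective (P i)
  d : ∀ i, (P (i + 1)).carrier →ₗ[A] (P i).carrier
  d_graded : ∀ i, IsGradedHom (d i)
  ε : (P 0).carrier →ₗ[A] M.carrier
  ε_graded : IsGradedHom ε
  ε_surjective : Function.Surjective ε
  exact_zero : Function.Exact (d 0) ε
  exact_succ : ∀ i, Function.Exact (d (i + 1)) (d i)

/-- The resolution has length at most `n`. -/
def GradedProjectiveResolution.LengthLE {M : GrMod 𝒜} (R : GradedProjectiveResolution M)
    (n : ℕ) : Prop :=
  ∀ i, n < i → Subsingleton (R.P i).carrier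

/-- The graded projective dimension of `M`: the least length of a graded projective resolution
(`⊤` if there is no resolution of finite length). -/
noncomputable def gradedProjDim (M : GrMod 𝒜) : ℕ∞ :=
  ⨅ (n : ℕ) (_ : ∃ R : GradedProjectiveResolution M, R.LengthLE n), (n : ℕ∞)

variable (𝒜) in
/-- The graded (left) global dimension: the supremum of the graded projective dimensions of all
graded left modules. -/
noncomputable def gradedGlobalDim : ℕ∞ := ⨆ M : GrMod 𝒜, gradedProjDim M

end GradedModules

/-! ### The graded Jacobson radical and generalized AS regularity -/

section Regular

variable {k A : Type u} [Field k] [Ring A] [Algebra k A] (𝒜 : ℕ → Submodule k A)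
  [GradedAlgebra 𝒜]

/-- `I` is maximal among the proper homogeneous left ideals of `A`. (An `Ideal` of a
noncommutative ring is a left ideal.) -/
def IsMaximalHomogeneous (I : Ideal A) : Prop :=
  I.IsHomogeneous 𝒜 ∧ I ≠ ⊤ ∧ ∀ I' : Ideal A, I'.IsHomogeneous 𝒜 → I < I' → I' = ⊤

/-- The graded Jacobson radical `J(A)`: the intersection of the maximal homogeneous left ideals. -/
def gradedJacobson : Ideal A := sInf {I | IsMaximalHomogeneous 𝒜 I}

theorem isHomogeneous_gradedJacobson : (gradedJacobson 𝒜).IsHomogeneous 𝒜 :=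
  Ideal.IsHomogeneous.sInf fun _ hI => hI.1

/-- The left ideal `{x | x b ∈ I}`. -/
def rightColon (I : Ideal A) (b : A) : Ideal A := Submodule.comap (LinearMap.toSpanSingleton A A b) I

theorem mem_rightColon {I : Ideal A} {b x : A} : x ∈ rightColon I b ↔ x * b ∈ I := Iff.rfl

theorem isHomogeneous_rightColon {I : Ideal A} (hI : I.IsHomogeneous 𝒜) {n : ℕ} {b : A}
    (hb : b ∈ 𝒜 n) : (rightColon I b).IsHomogeneous 𝒜 := by
  intro i x hx
  rw [mem_rightColon] at hx
  change ((DirectSum.decompose 𝒜 x i : A)) * b ∈ I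
  have h := hI (i + n) hx
  rwa [DirectSum.coe_decompose_mul_of_right_mem_of_le 𝒜 hb (Nat.le_add_left n i),
    Nat.add_sub_cancel] at h

theorem gradedJacobson_mul_mem {a b : A} (ha : a ∈ gradedJacobson 𝒜) :
    a * b ∈ gradedJacobson 𝒜 := by
  induction b using DirectSum.Decomposition.inductionOn 𝒜 with
  | zero => simp
  | add x y hx hy => rw [mul_add]; exact add_mem hx hy
  | @homogeneous n b =>
    refine Submodule.mem_sInf.2 fun I hI => ?_
    obtain ⟨hIh, hIne, hImax⟩ := hI
    by_cases hb : (b : A) ∈ I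
    · exact Ideal.mul_mem_left I a hb
    suffices h : IsMaximalHomogeneous 𝒜 (rightColon I (b : A)) from
      mem_rightColon.1 (Submodule.mem_sInf.1 ha _ h)
    refine ⟨isHomogeneous_rightColon 𝒜 hIh b.2, ?_, ?_⟩
    · intro h
      have h1 : (1 : A) ∈ rightColon I (b : A) := h ▸ Submodule.mem_top
      rw [mem_rightColon, one_mul] at h1
      exact hb h1
    · intro I' hI' hlt
      obtain ⟨c, hcI', hc⟩ := SetLike.exists_of_lt hlt
      -- a homogeneous component of `c` lies outside
      obtain ⟨i, hi⟩ : ∃ i, (DirectSum.decompose 𝒜 c i : A) ∉ rightColon I (b : A) := by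
        by_contra! hall
        exact hc ((isHomogeneous_rightColon 𝒜 hIh b.2).mem_iff.2 hall)
      have hiI' : (DirectSum.decompose 𝒜 c i : A) ∈ I' := hI' i hcI'
      set e : A := (DirectSum.decompose 𝒜 c i : A) with he
      have heb : SetLike.IsHomogeneousElem 𝒜 (e * b) :=
        ⟨i + n, SetLike.mul_mem_graded (DirectSum.decompose 𝒜 c i).2 b.2⟩
      have hspan : (Ideal.span {e * (b : A)}).IsHomogeneous 𝒜 :=
        Ideal.homogeneous_span 𝒜 _ (by rintro _ rfl; exact heb)
      have htop : I ⊔ Ideal.span {e * (b : A)} = ⊤ := by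
        refine hImax _ (hIh.sup hspan) ?_
        refine lt_of_le_of_ne le_sup_left fun h => hi ?_
        rw [mem_rightColon, h]
        exact Ideal.mem_sup_right (Ideal.mem_span_singleton_self _)
      obtain ⟨m, hm, y, hy, hmy⟩ := Submodule.mem_sup.1
        (htop ▸ Submodule.mem_top : (b : A) ∈ I ⊔ Ideal.span {e * (b : A)})
      obtain ⟨z, rfl⟩ := Ideal.mem_span_singleton'.1 hy
      rw [Ideal.eq_top_iff_one]
      have h1 : 1 - z * e ∈ rightColon I (b : A) := by
        rw [mem_rightColon, sub_mul, one_mul, mul_assoc]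
        rw [← eq_sub_iff_add_eq] at hmy
        rwa [← hmy]
      have h2 := I'.add_mem (hlt.le h1) (Ideal.mul_mem_left I' z hiI')
      simpa using h2

instance : (gradedJacobson 𝒜).IsTwoSided := ⟨fun _ ha => gradedJacobson_mul_mem 𝒜 ha⟩

/-- The algebra `S = A / J(A)`. -/
abbrev SemisimpleQuotient : Type u := A ⧸ gradedJacobson 𝒜

/-- Right multiplication by `s ∈ S` on the left `A`-module `S = A / J(A)`. -/
def quotMulRight (s : SemisimpleQuotient 𝒜) :
    SemisimpleQuotient 𝒜 →ₗ[A] SemisimpleQuotient 𝒜 where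
  toFun x := x * s
  map_add' x y := add_mul x y s
  map_smul' a x := by
    obtain ⟨x, rfl⟩ := Ideal.Quotient.mk_surjective x
    obtain ⟨s, rfl⟩ := Ideal.Quotient.mk_surjective s
    exact congrArg (Ideal.Quotient.mk (gradedJacobson 𝒜)) (mul_assoc a x s)

/-- The group `Ext^i_A(S, A)` of left `A`-modules, where `S = A / J(A)`. -/
abbrev ExtSA (i : ℕ) : Type u :=
  Abelian.Ext.{u} (ModuleCat.of A (SemisimpleQuotient 𝒜)) (ModuleCat.of A A) i

/-- The left action of `s ∈ S` on `Ext^i_A(S, A)`, induced by right multiplication by `s` on `S`. -/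
noncomputable def ExtSA.leftAct {i : ℕ} (s : SemisimpleQuotient 𝒜) (x : ExtSA 𝒜 i) : ExtSA 𝒜 i :=
  (Abelian.Ext.mk₀ (ModuleCat.ofHom (quotMulRight 𝒜 s))).comp x (zero_add i)

/-- The right action of `a ∈ A` on `Ext^i_A(S, A)`, induced by right multiplication by `a` on `A`. -/
noncomputable def ExtSA.rightAct {i : ℕ} (x : ExtSA 𝒜 i) (a : A) : ExtSA 𝒜 i :=
  x.comp (Abelian.Ext.mk₀ (ModuleCat.ofHom (LinearMap.toSpanSingleton A A a))) (add_zero i)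

/-- The graded algebra `A = ⨁ n, 𝒜 n` is generalized AS regular of dimension `d`: its graded global
dimension is `d`, `Ext^i_A(S, A) = 0` for `i ≠ d`, and `Ext^d_A(S, A)` is isomorphic to a
`k`-central invertible `(S, S)`-bimodule `U`. In the last clause the right action of `S = A / J(A)`
on `U` is compared with the right action of `A` on `Ext^d_A(S, A)` through `A → S`. -/
def IsGeneralizedASRegular (d : ℕ) : Prop :=
  gradedGlobalDim 𝒜 = d ∧
  (∀ i : ℕ, i ≠ d → Subsingleton (ExtSA 𝒜 i)) ∧
  ∃ U : CentralBimodule k (SemisimpleQuotient 𝒜),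
    IsInvertibleBimodule k (SemisimpleQuotient 𝒜) U.carrier ∧
    ∃ e : ExtSA 𝒜 d ≃+ U.carrier,
      (∀ (s : SemisimpleQuotient 𝒜) (x : ExtSA 𝒜 d), e (ExtSA.leftAct 𝒜 s x) = s • e x) ∧
      (∀ (x : ExtSA 𝒜 d) (a : A), e (ExtSA.rightAct 𝒜 x a) =
        MulOpposite.op (Ideal.Quotient.mk (gradedJacobson 𝒜) a) • e x)

end Regular

/-!
Let `A = T_S(V)`, let `ε : A → S` be the augmentation and `J = ker ε = V · A`.

Since `S` is semisimple and the degree-zero part of `A` is finite-dimensional, the graded Jacobson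
radical of `A` is `J` (`gradedJacobson_eq_augIdeal`): right multiplication by a homogeneous element
of degree zero which is `1` modulo `J` is injective on `A₀`, because `⋂ n, J ^ n = 0`, and therefore
the element is invertible. As a left `A`-module, `J ≅ A ⊗_S V` is induced from `S`: a left
`S`-linear map from `V` to an `A`-module extends uniquely to `J` (`exists_extend_augIdeal`,
`augIdeal_linearMap_ext`), and so `J` is projective.

*Global dimension.* The graded global dimension is at most one because submodules of graded
projective modules are graded projective (`isGradedProjective_of_injective`). To lift a map from
such a submodule, lift it `S`-linearly; the failure of this lift to be `A`-linear is a cocycle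
`V × F → X`, which is a coboundary since it defines an extension of a projective module (`twist`).
The dimension is not zero: a splitting of `A → S` would give an element `a` of degree zero with
`ε(a) = 1` and `V a = 0`, but such an `a` is invertible (`gradedGlobalDim_ne_zero`).

*Ext groups.* From `0 → J → A → A / J → 0` one gets `Extⁱ_A(S, A) = 0` for `i ≥ 2`; `Ext⁰_A(S, A)`
consists of the elements which are killed by `V` from the left, and `Ext¹_A(S, A)` is the cokernel
of the map `A → Hom_S(V, A)`, `a ↦ (v ↦ v a)` (`exists_extConnecting`).

*Invertibility.* As `S` is semisimple and `V` is finitely generated, `V` is invertible if and only if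
`S → End_S(V)`, given by right multiplication, is bijective and `V` is a generator
(`IsMoritaBimodule`); then `Hom_S(V, S)` is the inverse of `V`. If `V` is invertible, the components of `A → Hom_S(V, A)` of
positive length are isomorphisms, so that `Ext⁰` vanishes and `Ext¹` is the invertible bimodule
`Hom_S(V, S)`. Conversely, if `Ext⁰ = 0` and `Ext¹` is an invertible bimodule, the three parts of
the Morita criterion can be read off from the same map
(`isMoritaBimodule_of_isGeneralizedASRegular`).
-/

/-! ### Structure of the tensor algebra -/

namespace BimoduleTensorAlgebra

section Structure

variable {k S V : Type u} [Field k] [Ring S] [Algebra k S]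
  [AddCommGroup V] [Module k V] [Module S V] [Module Sᵐᵒᵖ V]

theorem induction_on {C : BimoduleTensorAlgebra k S V → Prop} (x : BimoduleTensorAlgebra k S V)
    (ring : ∀ s, C (ofRing k S V s)) (bimodule : ∀ v, C (ofBimodule k S V v))
    (add : ∀ x y, C x → C y → C (x + y)) (mul : ∀ x y, C x → C y → C (x * y)) : C x := by
  obtain ⟨x, rfl⟩ : ∃ y, mk k S V y = x := RingQuot.mkAlgHom_surjective k _ x
  induction x using TensorAlgebra.induction with
  | algebraMap r =>
    rw [AlgHom.commutes, ← AlgHom.commutes (ofRing k S V)]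
    exact ring _
  | ι p =>
    have h : mk k S V (TensorAlgebra.ι k p) = ofRing k S V p.1 + ofBimodule k S V p.2 := by
      change _ = mk k S V (TensorAlgebra.ι k (p.1, 0)) + mk k S V (TensorAlgebra.ι k (0, p.2))
      rw [← map_add, ← map_add]
      simp
    rw [h]
    exact add _ _ (ring _) (bimodule _)
  | mul a b ha hb => rw [map_mul]; exact mul _ _ ha hb
  | add a b ha hb => rw [map_add]; exact add _ _ ha hb

variable (k S V) in
/-- The augmentation `T_S(V) → S`, which kills `V`. -/
noncomputable def augmentation : BimoduleTensorAlgebra k S V →ₐ[k] S :=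
  lift (AlgHom.id k S) 0 (by simp) (by simp)

@[simp] theorem augmentation_ofRing (s : S) : augmentation k S V (ofRing k S V s) = s :=
  lift_ofRing _ _ _ _ s

@[simp] theorem augmentation_ofBimodule (v : V) : augmentation k S V (ofBimodule k S V v) = 0 :=
  lift_ofBimodule _ _ _ _ v

variable (k S V) in
/-- The augmentation ideal `⨁ r ≥ 1, V^{⊗ r}`. -/
noncomputable abbrev augIdeal : Ideal (BimoduleTensorAlgebra k S V) :=
  RingHom.ker (augmentation k S V)

theorem ofBimodule_mem_augIdeal (v : V) : ofBimodule k S V v ∈ augIdeal k S V :=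
  augmentation_ofBimodule v

theorem mul_mem_augIdeal {x : BimoduleTensorAlgebra k S V} (hx : x ∈ augIdeal k S V)
    (y : BimoduleTensorAlgebra k S V) : x * y ∈ augIdeal k S V := by
  rw [RingHom.mem_ker] at hx ⊢
  rw [map_mul, hx, zero_mul]

theorem sub_ofRing_augmentation_mem (x : BimoduleTensorAlgebra k S V) :
    x - ofRing k S V (augmentation k S V x) ∈ augIdeal k S V := by
  rw [RingHom.mem_ker, map_sub, augmentation_ofRing, sub_self]

theorem augIdeal_eq_span :
    augIdeal k S V = Submodule.span _ (Set.range (ofBimodule k S V)) := by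
  apply le_antisymm
  · have hr : ∀ (s : S), ∀ x ∈ Submodule.span (BimoduleTensorAlgebra k S V)
        (Set.range (ofBimodule k S V)),
        x * ofRing k S V s ∈ Submodule.span (BimoduleTensorAlgebra k S V)
          (Set.range (ofBimodule k S V)) := by
      intro s x hx
      induction hx using Submodule.span_induction with
      | mem x hx =>
        obtain ⟨v, rfl⟩ := hx
        rw [← ofBimodule_op_smul]
        exact Submodule.subset_span ⟨_, rfl⟩
      | zero => simp
      | add x y _ _ hx hy => rw [add_mul]; exact add_mem hx hy
      | smul a x _ hx => rw [smul_eq_mul, mul_assoc]; exact Submodule.smul_mem _ _ hx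
    have key : ∀ x : BimoduleTensorAlgebra k S V, x - ofRing k S V (augmentation k S V x) ∈
        Submodule.span (BimoduleTensorAlgebra k S V) (Set.range (ofBimodule k S V)) := by
      intro x
      induction x using induction_on with
      | ring s => simp
      | bimodule v => simpa using Submodule.subset_span (Set.mem_range_self v)
      | add x y hx hy =>
        rw [map_add, map_add, add_sub_add_comm]
        exact add_mem hx hy
      | mul x y hx hy =>
        have h : x * y - ofRing k S V (augmentation k S V (x * y)) =
            x • (y - ofRing k S V (augmentation k S V y)) +
            (x - ofRing k S V (augmentation k S V x)) * ofRing k S V (augmentation k S V y) := by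
          rw [map_mul, map_mul, smul_eq_mul]; noncomm_ring
        rw [h]
        exact add_mem (Submodule.smul_mem _ _ hy) (hr _ _ hx)
    intro x hx
    have h := key x
    rwa [RingHom.mem_ker.1 hx, map_zero, sub_zero] at h
  · rw [Submodule.span_le]
    rintro _ ⟨v, rfl⟩
    exact ofBimodule_mem_augIdeal v

/-- The augmentation ideal is also generated by `V` from the other side: it is `V · T_S(V)`. -/
theorem mem_span_op_of_mem_augIdeal {x : BimoduleTensorAlgebra k S V} (hx : x ∈ augIdeal k S V) :
    x ∈ Submodule.span (BimoduleTensorAlgebra k S V)ᵐᵒᵖ (Set.range (ofBimodule k S V)) := by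
  have hl : ∀ (s : S), ∀ x ∈ Submodule.span (BimoduleTensorAlgebra k S V)ᵐᵒᵖ
      (Set.range (ofBimodule k S V)),
      ofRing k S V s * x ∈ Submodule.span (BimoduleTensorAlgebra k S V)ᵐᵒᵖ
        (Set.range (ofBimodule k S V)) := by
    intro s x hx
    induction hx using Submodule.span_induction with
    | mem x hx =>
      obtain ⟨v, rfl⟩ := hx
      rw [← ofBimodule_smul]
      exact Submodule.subset_span ⟨_, rfl⟩
    | zero => simp
    | add x y _ _ hx hy => rw [mul_add]; exact add_mem hx hy
    | smul a x _ hx =>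
      rw [mul_smul_comm]; exact Submodule.smul_mem _ _ hx
  have key : ∀ x : BimoduleTensorAlgebra k S V, x - ofRing k S V (augmentation k S V x) ∈
      Submodule.span (BimoduleTensorAlgebra k S V)ᵐᵒᵖ (Set.range (ofBimodule k S V)) := by
    intro x
    induction x using induction_on with
    | ring s => simp
    | bimodule v => simpa using Submodule.subset_span (Set.mem_range_self v)
    | add x y hx hy =>
      rw [map_add, map_add, add_sub_add_comm]
      exact add_mem hx hy
    | mul x y hx hy =>
      have h : x * y - ofRing k S V (augmentation k S V (x * y)) =
          MulOpposite.op y • (x - ofRing k S V (augmentation k S V x)) +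
          ofRing k S V (augmentation k S V x) * (y - ofRing k S V (augmentation k S V y)) := by
        rw [map_mul, map_mul, op_smul_eq_mul]; noncomm_ring
      rw [h]
      exact add_mem (Submodule.smul_mem _ _ hx) (hl _ _ hy)
  have h := key x
  rwa [RingHom.mem_ker.1 hx, map_zero, sub_zero] at h

theorem augIdeal_linearMap_ext {M : Type u} [AddCommGroup M]
    [Module (BimoduleTensorAlgebra k S V) M] {D E : augIdeal k S V →ₗ[BimoduleTensorAlgebra k S V] M}
    (h : ∀ v, D ⟨ofBimodule k S V v, ofBimodule_mem_augIdeal v⟩ =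
      E ⟨ofBimodule k S V v, ofBimodule_mem_augIdeal v⟩) : D = E := by
  have key : ∀ x (hx : x ∈ Submodule.span (BimoduleTensorAlgebra k S V)
      (Set.range (ofBimodule k S V))) (hx' : x ∈ augIdeal k S V), D ⟨x, hx'⟩ = E ⟨x, hx'⟩ := by
    intro x hx
    induction hx using Submodule.span_induction with
    | mem x hx => obtain ⟨v, rfl⟩ := hx; exact fun _ => h v
    | zero => intro hx'; exact (map_zero D).trans (map_zero E).symm
    | add x y hx hy ihx ihy =>
      rw [← augIdeal_eq_span] at hx hy
      intro _
      exact (map_add D ⟨x, hx⟩ ⟨y, hy⟩).trans (by rw [ihx, ihy, ← map_add])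
    | smul a x hx ih =>
      rw [← augIdeal_eq_span] at hx
      intro _
      exact (map_smul D a ⟨x, hx⟩).trans (by rw [ih, ← map_smul])
  ext ⟨x, hx⟩
  exact key x (augIdeal_eq_span (k := k) (S := S) (V := V) ▸ hx) hx

/-! ### Recording tensor length -/

variable (k S V) in
/-- The algebra map `T_S(V) → T_S(V)[X]` which multiplies a tensor of length `r` by `X ^ r`. -/
noncomputable def lengthHom :
    BimoduleTensorAlgebra k S V →ₐ[k] Polynomial (BimoduleTensorAlgebra k S V) :=
  lift ((Polynomial.CAlgHom).comp (ofRing k S V))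
    { toFun := fun v => Polynomial.C (ofBimodule k S V v) * Polynomial.X
      map_add' := by intro v w; simp [add_mul]
      map_smul' := by intro c v; simp [← Polynomial.smul_C] }
    (by intro s v; simp [ofBimodule_smul, mul_assoc])
    (by intro s v; simp [ofBimodule_op_smul, mul_assoc])

theorem lengthHom_injective : Function.Injective (lengthHom k S V) := by
  let ev := Polynomial.eval₂RingHom' (RingHom.id (BimoduleTensorAlgebra k S V)) 1
    (fun a => Commute.one_right a)
  refine Function.LeftInverse.injective (g := ev) fun x => ?_
  induction x using induction_on with
  | ring s => simp [ev, lengthHom]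
  | bimodule v => simp [ev, lengthHom]
  | add x y hx hy => rw [map_add, map_add, hx, hy]
  | mul x y hx hy => rw [map_mul, map_mul, hx, hy]

theorem coeff_zero_lengthHom (x : BimoduleTensorAlgebra k S V) :
    (lengthHom k S V x).coeff 0 = ofRing k S V (augmentation k S V x) := by
  induction x using induction_on with
  | ring s => simp [lengthHom]
  | bimodule v => simp [lengthHom]
  | add x y hx hy => simp [hx, hy]
  | mul x y hx hy => simp [hx, hy]

/-- Since `⋂ n, J ^ n = 0` for the augmentation ideal `J`, right multiplication by an element of
`J` has no nonzero fixed points. -/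
theorem eq_zero_of_mul_eq_self {x y : BimoduleTensorAlgebra k S V} (hy : y ∈ augIdeal k S V)
    (hxy : x * y = x) : x = 0 := by
  apply lengthHom_injective
  rw [map_zero]
  have hy0 : (lengthHom k S V y).coeff 0 = 0 := by
    rw [coeff_zero_lengthHom, RingHom.mem_ker.1 hy, map_zero]
  have h : lengthHom k S V x * lengthHom k S V y = lengthHom k S V x := by rw [← map_mul, hxy]
  ext n
  induction n using Nat.strong_induction_on with
  | _ n ih =>
    rw [← h, Polynomial.coeff_mul, Polynomial.coeff_zero]
    refine Finset.sum_eq_zero fun p hp => ?_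
    rw [Finset.HasAntidiagonal.mem_antidiagonal] at hp
    rcases Nat.eq_zero_or_pos p.2 with h2 | h2
    · rw [h2, hy0, mul_zero]
    · rw [ih p.1 (by omega), Polynomial.coeff_zero, zero_mul]

end Structure

/-! ### Twisting a direct sum of modules -/

section Twist

variable {k S V : Type u} [Field k] [Ring S] [Algebra k S]
  [AddCommGroup V] [Module k V] [Module S V] [Module Sᵐᵒᵖ V]

section twist

variable {X F : Type u} [AddCommGroup X] [Module k X] [Module (BimoduleTensorAlgebra k S V) X]
  [IsScalarTower k (BimoduleTensorAlgebra k S V) X]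
  [AddCommGroup F] [Module k F] [Module (BimoduleTensorAlgebra k S V) F]
  [IsScalarTower k (BimoduleTensorAlgebra k S V) F]
  (c : V →ₗ[k] F →ₗ[k] X)
  (hl : ∀ s v p, c (s • v) p = ofRing k S V s • c v p)
  (hr : ∀ s v p, c (MulOpposite.op s • v) p = c v (ofRing k S V s • p))

/-- A `k`-bilinear `c : V × F → X` that is `S`-linear in `V` and `S`-balanced makes `X × F` into an
extension of the `T_S(V)`-module `F` by `X`, in which `v (x, p) = (v x + c(v, p), v p)`. -/
noncomputable def twist : BimoduleTensorAlgebra k S V →ₐ[k] Module.End k (X × F) :=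
  lift ((Algebra.lsmul k k (X × F)).comp (ofRing k S V))
    (LinearMap.mk₂ k (fun v y => ofBimodule k S V v • y + (c v y.2, 0))
      (by intro v w y; ext <;> simp [add_smul]; abel)
      (by intro r v y; ext <;> simp)
      (by intro v y z; ext <;> simp; abel)
      (by intro r v y; ext <;> simp [smul_comm _ r]))
    (by
      intro s v
      ext y <;> simp [ofBimodule_smul, hl, mul_smul])
    (by
      intro s v
      ext y <;> simp [ofBimodule_op_smul, hr, mul_smul])

theorem twist_ofRing (s : S) (y : X × F) : twist c hl hr (ofRing k S V s) y = ofRing k S V s • y := by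
  simp [twist]

theorem twist_ofBimodule (v : V) (y : X × F) :
    twist c hl hr (ofBimodule k S V v) y = ofBimodule k S V v • y + (c v y.2, 0) := by
  simp [twist]

theorem twist_snd (a : BimoduleTensorAlgebra k S V) (y : X × F) :
    (twist c hl hr a y).2 = a • y.2 := by
  induction a using induction_on generalizing y with
  | ring s => simp [twist_ofRing]
  | bimodule v => simp [twist_ofBimodule]
  | add a b ha hb => simp [add_smul, ha, hb]
  | mul a b ha hb => rw [map_mul, Module.End.mul_apply, ha, hb, mul_smul]

/-- Over a submodule `K` of `F` on which `c` vanishes the extension is trivial. -/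
theorem twist_fst_of_mem (K : Submodule (BimoduleTensorAlgebra k S V) F)
    (hK : ∀ v, ∀ p ∈ K, c v p = 0) (a : BimoduleTensorAlgebra k S V) (y : X × F) (hy : y.2 ∈ K) :
    (twist c hl hr a y).1 = a • y.1 := by
  induction a using induction_on generalizing y with
  | ring s => simp [twist_ofRing]
  | bimodule v => simp [twist_ofBimodule, hK v _ hy]
  | add a b ha hb => simp [add_smul, ha y hy, hb y hy]
  | mul a b ha hb =>
    rw [map_mul, Module.End.mul_apply, ha _ (by rw [twist_snd]; exact K.smul_mem _ hy), hb y hy,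
      mul_smul]

end twist

variable [SMulCommClass S Sᵐᵒᵖ V] [IsScalarTower k S V]

/-- If the right `S`-linear map `u : V → T_S(V)` is extended to the augmentation ideal `V ⊗_S T_S(V)`
by `v a ↦ u(v) a`, then the extension sends `v a = 0` to `u(v) a`. The extension is read off from
the right module structure on `T_S(V) × T_S(V)` in which
`(y, b) v = (y v + u(ε(b) v), b v)`, `ε` being the augmentation. -/
theorem apply_mul_eq_zero_of_ofBimodule_mul_eq_zero (u : V →ₗ[k] BimoduleTensorAlgebra k S V)
    (hu : ∀ s v, u (MulOpposite.op s • v) = u v * ofRing k S V s)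
    {a : BimoduleTensorAlgebra k S V} {v : V} (ha : ofBimodule k S V v * a = 0) :
    u v * a = 0 := by
  let B := BimoduleTensorAlgebra k S V
  let f : S →ₐ[k] (Module.End k (B × B))ᵐᵒᵖ :=
    AlgHom.ofLinearMap
      { toFun := fun s => MulOpposite.op
          (LinearMap.prodMap (LinearMap.mulRight k (ofRing k S V s))
            (LinearMap.mulRight k (ofRing k S V s)))
        map_add' := fun s t => by
          apply MulOpposite.unop_injective
          ext y <;> simp [mul_add]
        map_smul' := fun r s => by
          apply MulOpposite.unop_injective
          ext y <;> simp }
      (by apply MulOpposite.unop_injective; ext y <;> simp)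
      (fun s t => by
        apply MulOpposite.unop_injective
        ext y <;> simp [mul_assoc])
  have hf : ∀ s (y : B × B), (f s).unop y = (y.1 * ofRing k S V s, y.2 * ofRing k S V s) :=
    fun s y => rfl
  let g : V →ₗ[k] (Module.End k (B × B))ᵐᵒᵖ := (MulOpposite.opLinearEquiv k).toLinearMap ∘ₗ
    LinearMap.mk₂ k (fun v (y : B × B) => ((y.1 * ofBimodule k S V v +
        u (augmentation k S V y.2 • v), y.2 * ofBimodule k S V v) : B × B))
      (by intro v w y; ext <;> simp [mul_add]; abel)
      (by intro r v y; ext <;> simp [smul_comm _ r])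
      (by intro v y z; ext <;> simp [add_mul, add_smul]; abel)
      (by intro r v y; ext <;> simp)
  have hg : ∀ v (y : B × B), (g v).unop y =
      (y.1 * ofBimodule k S V v + u (augmentation k S V y.2 • v), y.2 * ofBimodule k S V v) :=
    fun v y => rfl
  let Ψ : B →ₐ[k] (Module.End k (B × B))ᵐᵒᵖ := lift f g
    (fun s v => by
      apply MulOpposite.unop_injective
      refine LinearMap.ext fun y => ?_
      rw [MulOpposite.unop_mul, Module.End.mul_apply, hg, hg, hf, ofBimodule_smul]
      simp [mul_assoc, mul_smul])
    (fun s v => by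
      apply MulOpposite.unop_injective
      refine LinearMap.ext fun y => ?_
      rw [MulOpposite.unop_mul, Module.End.mul_apply, hf, hg, hg, ofBimodule_op_smul, smul_comm, hu]
      simp [mul_assoc, add_mul])
  have hΨf : ∀ s, Ψ (ofRing k S V s) = f s := fun s => lift_ofRing _ _ _ _ s
  have hΨg : ∀ v, Ψ (ofBimodule k S V v) = g v := fun v => lift_ofBimodule _ _ _ _ v
  have hΨ : ∀ a (y : B × B), ((Ψ a).unop y).2 = y.2 * a ∧
      (y.2 ∈ augIdeal k S V → ((Ψ a).unop y).1 = y.1 * a) := by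
    intro a
    induction a using induction_on with
    | ring s => intro y; simp [hΨf, hf]
    | bimodule v =>
      intro y
      simp only [hΨg, hg, true_and]
      intro hy
      rw [RingHom.mem_ker.1 hy, zero_smul, map_zero, add_zero]
    | add a b ha hb =>
      intro y
      refine ⟨?_, fun hy => ?_⟩
      · simp [mul_add, (ha y).1, (hb y).1]
      · simp [mul_add, (ha y).2 hy, (hb y).2 hy]
    | mul a b ha hb =>
      intro y
      rw [map_mul, MulOpposite.unop_mul, Module.End.mul_apply]
      refine ⟨?_, fun hy => ?_⟩
      · rw [(hb _).1, (ha _).1, mul_assoc]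
      · rw [(hb _).2 (by rw [(ha _).1]; exact mul_mem_augIdeal hy a), (ha _).2 hy, mul_assoc]
  have h1 : (Ψ (ofBimodule k S V v)).unop (0, 1) = (u v, ofBimodule k S V v) := by
    simp [hΨg, hg]
  have h2 : ((Ψ (ofBimodule k S V v * a)).unop (0, 1)).1 = u v * a := by
    rw [map_mul, MulOpposite.unop_mul, Module.End.mul_apply, h1]
    exact (hΨ a _).2 (ofBimodule_mem_augIdeal v)
  rw [← h2, ha]
  simp

variable [IsScalarTower k Sᵐᵒᵖ V]

/-- The augmentation ideal is `T_S(V) ⊗_S V`: every `S`-linear map from `V` to a `T_S(V)`-module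
extends to it. -/
theorem exists_extend_augIdeal {M : Type u} [AddCommGroup M]
    [Module (BimoduleTensorAlgebra k S V) M] (g : V →+ M)
    (hg : ∀ s v, g (s • v) = ofRing k S V s • g v) :
    ∃ D : augIdeal k S V →ₗ[BimoduleTensorAlgebra k S V] M,
      ∀ v, D ⟨ofBimodule k S V v, ofBimodule_mem_augIdeal v⟩ = g v := by
  let : Module k M := Module.compHom M (algebraMap k (BimoduleTensorAlgebra k S V))
  have : IsScalarTower k (BimoduleTensorAlgebra k S V) M :=
    ⟨fun r a m => by rw [Algebra.smul_def, mul_smul]; rfl⟩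
  have hk : ∀ (r : k) (v : V), g (r • v) = r • g v := fun r v => by
    rw [← algebraMap_smul S r v, hg, AlgHom.commutes]; rfl
  let c : V →ₗ[k] BimoduleTensorAlgebra k S V →ₗ[k] M :=
    LinearMap.mk₂ k (fun v p => g (MulOpposite.op (augmentation k S V p) • v))
      (by intro v w p; simp)
      (by intro r v p; rw [smul_comm, hk])
      (by intro v p q; simp [add_smul])
      (by intro r v p; rw [← hk, map_smul (augmentation k S V), MulOpposite.op_smul, smul_assoc])
  have hl : ∀ s v p, c (s • v) p = ofRing k S V s • c v p := fun s v p => by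
    simp only [c, LinearMap.mk₂_apply]
    rw [← smul_comm, hg]
  have hr : ∀ s v p, c (MulOpposite.op s • v) p = c v (ofRing k S V s • p) := fun s v p => by
    simp [c, mul_smul]
  have hJ : ∀ a y, y.2 ∈ augIdeal k S V → (twist c hl hr a y).1 = a • y.1 := fun a y hy =>
    twist_fst_of_mem c hl hr (augIdeal k S V)
      (fun v p hp => by simp [c, RingHom.mem_ker.1 hp]) a y hy
  refine ⟨{ toFun := fun p => (twist c hl hr p (0, 1)).1
            map_add' := fun p q => by simp
            map_smul' := fun a p => ?_ }, fun v => ?_⟩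
  · simp only [SetLike.val_smul, smul_eq_mul, map_mul, Module.End.mul_apply, RingHom.id_apply]
    refine hJ a _ ?_
    rw [twist_snd, smul_eq_mul, mul_one]
    exact p.2
  · change (twist c hl hr (ofBimodule k S V v) (0, 1)).1 = g v
    simp [twist_ofBimodule, c]

variable (k S V) in
/-- The projection of the augmentation ideal onto `V`. -/
theorem exists_augIdeal_projection :
    ∃ q : augIdeal k S V →+ V,
      (∀ v, q ⟨ofBimodule k S V v, ofBimodule_mem_augIdeal v⟩ = v) ∧
      ∀ (a : BimoduleTensorAlgebra k S V) (x : augIdeal k S V),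
        q (a • x) = augmentation k S V a • q x := by
  let : Module (BimoduleTensorAlgebra k S V) V :=
    Module.compHom V (augmentation k S V).toRingHom
  obtain ⟨D, hD⟩ := exists_extend_augIdeal (k := k) (S := S) (AddMonoidHom.id V) fun s v => by
    change s • v = augmentation k S V (ofRing k S V s) • v
    rw [augmentation_ofRing]
  exact ⟨D.toAddMonoidHom, hD, fun a x => map_smul D a x⟩

theorem ofBimodule_injective : Function.Injective (ofBimodule k S V) := by
  obtain ⟨q, hq, -⟩ := exists_augIdeal_projection k S V
  intro v w h
  rw [← hq v, ← hq w]
  congr 1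
  exact Subtype.ext h

end Twist

end BimoduleTensorAlgebra

/-! ### Gradings given by projections -/

theorem DirectSum.isInternal_of_projections {ι X : Type*} [DecidableEq ι] [AddCommGroup X]
    (P : ι → AddSubgroup X) (p : ι → X →+ X) (mem : ∀ j x, p j x ∈ P j)
    (id : ∀ j, ∀ x ∈ P j, p j x = x) (zero : ∀ i j, i ≠ j → ∀ x ∈ P i, p j x = 0)
    (fin : ∀ x, {j | p j x ≠ 0}.Finite) (ext : ∀ x, (∀ j, p j x = 0) → x = 0) :
    DirectSum.IsInternal P := by
  have hp : ∀ (z : ⨁ j, P j) j, p j (DirectSum.coeAddMonoidHom P z) = z j := by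
    intro z j
    induction z using DirectSum.induction_on with
    | zero => simp
    | of i x =>
      rw [DirectSum.coeAddMonoidHom_of]
      rcases eq_or_ne i j with rfl | h
      · rw [id _ _ x.2, DirectSum.of_eq_same]
      · rw [zero i j h _ x.2, DirectSum.of_eq_of_ne _ _ _ h.symm]; rfl
    | add a b ha hb => rw [map_add, map_add, ha, hb]; rfl
  constructor
  · refine (injective_iff_map_eq_zero _).2 fun z hz => ?_
    ext j
    rw [← hp, hz, map_zero]; rfl
  · intro x
    refine ⟨∑ j ∈ (fin x).toFinset, DirectSum.of (fun j => P j) j ⟨p j x, mem j x⟩, ?_⟩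
    rw [← sub_eq_zero]
    refine ext _ fun i => ?_
    rw [map_sub, map_sum, map_sum]
    simp only [DirectSum.coeAddMonoidHom_of]
    rw [sub_eq_zero, Finset.sum_eq_single i]
    · exact id i _ (mem i x)
    · intro j _ hj; exact zero j i hj _ (mem j x)
    · intro hi
      have : p i x = 0 := by simpa using hi
      rw [this, map_zero]

/-! ### Homogeneous components of graded modules -/

section GradedModules

variable {k A : Type u} [Field k] [Ring A] [Algebra k A] {𝒜 : ℕ → Submodule k A}

namespace GrMod

variable (M N : GrMod 𝒜)

/-- The isomorphism of a graded module with the direct sum of its homogeneous components. -/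
noncomputable def equivDirectSum : (⨁ j, M.piece j) ≃+ M.carrier :=
  AddEquiv.ofBijective (DirectSum.coeAddMonoidHom M.piece) M.isInternal

/-- The projection of a graded module onto its component of degree `j`. -/
noncomputable def proj (j : ℤ) : M.carrier →+ M.carrier :=
  (M.piece j).subtype.comp
    ((DFinsupp.evalAddMonoidHom j).comp M.equivDirectSum.symm.toAddMonoidHom)

theorem proj_mem (j : ℤ) (m : M.carrier) : M.proj j m ∈ M.piece j :=
  (M.equivDirectSum.symm m j).2

variable {M N}

theorem equivDirectSum_symm_of_mem {j : ℤ} {m : M.carrier} (hm : m ∈ M.piece j) :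
    M.equivDirectSum.symm m = DirectSum.of (fun j => M.piece j) j ⟨m, hm⟩ := by
  rw [AddEquiv.symm_apply_eq]
  exact (DirectSum.coeAddMonoidHom_of M.piece j ⟨m, hm⟩).symm

theorem proj_of_mem {j : ℤ} {m : M.carrier} (hm : m ∈ M.piece j) : M.proj j m = m := by
  change ((M.equivDirectSum.symm m j : M.piece j) : M.carrier) = m
  rw [equivDirectSum_symm_of_mem hm, DirectSum.of_eq_same]

theorem proj_of_mem_ne {i j : ℤ} (h : i ≠ j) {m : M.carrier} (hm : m ∈ M.piece i) :
    M.proj j m = 0 := by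
  change ((M.equivDirectSum.symm m j : M.piece j) : M.carrier) = 0
  rw [equivDirectSum_symm_of_mem hm, DirectSum.of_eq_of_ne _ _ _ h.symm]; rfl

theorem eq_zero_of_proj {m : M.carrier} (h : ∀ j, M.proj j m = 0) : m = 0 := by
  rw [← M.equivDirectSum.symm.map_eq_zero_iff]
  ext j
  exact h j

theorem finite_proj (m : M.carrier) : {j | M.proj j m ≠ 0}.Finite := by
  refine (DFinsupp.finite_support (M.equivDirectSum.symm m)).subset fun j hj h => hj ?_
  change ((M.equivDirectSum.symm m j : M.piece j) : M.carrier) = 0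
  rw [h]; rfl

theorem induction_on {C : M.carrier → Prop} (m : M.carrier)
    (zero : C 0) (homogeneous : ∀ j, ∀ x ∈ M.piece j, C x) (add : ∀ x y, C x → C y → C (x + y)) :
    C m := by
  obtain ⟨z, rfl⟩ := M.equivDirectSum.surjective m
  induction z using DirectSum.induction_on with
  | zero => rwa [map_zero]
  | of i x =>
    have : M.equivDirectSum (DirectSum.of (fun j => M.piece j) i x) = x :=
      DirectSum.coeAddMonoidHom_of M.piece i x
    rw [this]
    exact homogeneous i _ x.2
  | add a b ha hb => rw [map_add]; exact add _ _ ha hb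

theorem proj_smul_of_mem_zero {a : A} (ha : a ∈ 𝒜 0) (j : ℤ) (m : M.carrier) :
    M.proj j (a • m) = a • M.proj j m := by
  induction m using induction_on with
  | zero => simp
  | homogeneous i x hx =>
    have hax : a • x ∈ M.piece i := by simpa using M.smul_mem 0 i a x ha hx
    rcases eq_or_ne i j with rfl | h
    · rw [proj_of_mem hx, proj_of_mem hax]
    · rw [proj_of_mem_ne h hx, proj_of_mem_ne h hax, smul_zero]
  | add x y hx hy => rw [smul_add, map_add, map_add, smul_add, hx, hy]

theorem map_proj {f : M.carrier →ₗ[A] N.carrier} (hf : IsGradedHom f) (j : ℤ) (m : M.carrier) :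
    f (M.proj j m) = N.proj j (f m) := by
  induction m using induction_on with
  | zero => simp
  | homogeneous i x hx =>
    rcases eq_or_ne i j with rfl | h
    · rw [proj_of_mem hx, proj_of_mem (hf _ _ hx)]
    · rw [proj_of_mem_ne h hx, proj_of_mem_ne h (hf _ _ hx), map_zero]
  | add x y hx hy => simp only [map_add, hx, hy]

variable (M N) in
/-- The part of degree zero of an additive map between graded modules. -/
noncomputable def homogenize (φ : M.carrier →+ N.carrier) : M.carrier →+ N.carrier :=
  (DirectSum.toAddMonoid fun j => (N.proj j).comp (φ.comp (M.piece j).subtype)).comp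
    M.equivDirectSum.symm.toAddMonoidHom

theorem homogenize_of_mem (φ : M.carrier →+ N.carrier) {j : ℤ} {m : M.carrier}
    (hm : m ∈ M.piece j) : homogenize M N φ m = N.proj j (φ m) := by
  change DirectSum.toAddMonoid _ (M.equivDirectSum.symm m) = _
  rw [equivDirectSum_symm_of_mem hm, DirectSum.toAddMonoid_of]
  rfl

theorem homogenize_mem (φ : M.carrier →+ N.carrier) {j : ℤ} {m : M.carrier}
    (hm : m ∈ M.piece j) : homogenize M N φ m ∈ N.piece j := by
  rw [homogenize_of_mem φ hm]
  exact N.proj_mem _ _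

theorem homogenize_smul (φ : M.carrier →+ N.carrier) {a : A} (ha : a ∈ 𝒜 0)
    (hφ : ∀ m, φ (a • m) = a • φ m) (m : M.carrier) :
    homogenize M N φ (a • m) = a • homogenize M N φ m := by
  induction m using induction_on with
  | zero => simp
  | homogeneous i x hx =>
    have hax : a • x ∈ M.piece i := by simpa using M.smul_mem 0 i a x ha hx
    rw [homogenize_of_mem φ hx, homogenize_of_mem φ hax, hφ, proj_smul_of_mem_zero ha]
  | add x y hx hy => rw [smul_add, map_add, map_add, smul_add, hx, hy]

/-- The kernel of a homomorphism of graded modules. -/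
noncomputable def ker (f : M.carrier →ₗ[A] N.carrier) (hf : IsGradedHom f) : GrMod 𝒜 where
  carrier := LinearMap.ker f
  piece j := (M.piece j).comap (LinearMap.ker f).toAddSubgroup.subtype
  isInternal :=
    DirectSum.isInternal_of_projections _
      (fun j => ((M.proj j).comp (LinearMap.ker f).toAddSubgroup.subtype).codRestrict
        (LinearMap.ker f).toAddSubgroup fun x => by
          change f (M.proj j x) = 0
          rw [map_proj hf, show f x = 0 from x.2, map_zero])
      (fun j x => M.proj_mem j x)
      (fun j x hx => Subtype.ext (proj_of_mem hx))
      (fun i j h x hx => Subtype.ext (proj_of_mem_ne h hx))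
      (fun x => (M.finite_proj x).subset fun j hj h => hj (Subtype.ext h))
      (fun x h => Subtype.ext (eq_zero_of_proj fun j => congrArg Subtype.val (h j)))
  smul_mem i j a m ha hm := M.smul_mem i j a m ha hm

variable (𝒜) in
/-- The zero module. -/
def zero : GrMod 𝒜 where
  carrier := PUnit.{u + 1}
  piece _ := ⊤
  isInternal := DirectSum.isInternal_of_projections _ (fun _ => 0) (fun _ _ => trivial)
    (fun _ _ _ => rfl) (fun _ _ _ _ _ => rfl) (fun _ => by simp) (fun _ _ => rfl)
  smul_mem _ _ _ _ _ _ := trivial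

end GrMod

theorem IsGradedProjective.of_subsingleton (P : GrMod 𝒜) [Subsingleton P.carrier] :
    IsGradedProjective P := fun M N g f _ _ _ =>
  ⟨0, fun j m _ => zero_mem _, LinearMap.ext fun x => by
    rw [Subsingleton.elim x 0, map_zero, map_zero]⟩

/-! ### Graded free modules -/

namespace GrMod

variable (𝒜) in
/-- The homogeneous components of `A`, indexed by `ℤ`. -/
def intPiece : ℤ → AddSubgroup A
  | Int.ofNat n => (𝒜 n).toAddSubgroup
  | Int.negSucc _ => ⊥

variable [GradedAlgebra 𝒜]

variable (𝒜) in
/-- The projections of `A` onto its homogeneous components, indexed by `ℤ`. -/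
noncomputable def intProj : ℤ → A →+ A
  | Int.ofNat n => GradedRing.proj 𝒜 n
  | Int.negSucc _ => 0

theorem intProj_mem (j : ℤ) (a : A) : intProj 𝒜 j a ∈ intPiece 𝒜 j := by
  cases j with
  | ofNat n => exact (DirectSum.decompose 𝒜 a n).2
  | negSucc n => exact zero_mem _

theorem intProj_of_mem {j : ℤ} {a : A} (ha : a ∈ intPiece 𝒜 j) : intProj 𝒜 j a = a := by
  cases j with
  | ofNat n => exact DirectSum.decompose_of_mem_same 𝒜 ha
  | negSucc n => exact ((AddSubgroup.mem_bot).1 ha).symm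

theorem intProj_of_mem_ne {i j : ℤ} (h : i ≠ j) {a : A} (ha : a ∈ intPiece 𝒜 i) :
    intProj 𝒜 j a = 0 := by
  cases j with
  | negSucc n => rfl
  | ofNat n =>
    cases i with
    | ofNat m => exact DirectSum.decompose_of_mem_ne 𝒜 ha (fun e => h (by rw [e]))
    | negSucc m => rw [(AddSubgroup.mem_bot).1 ha, map_zero]

theorem finite_intProj (a : A) : {j | intProj 𝒜 j a ≠ 0}.Finite := by
  refine ((DFinsupp.finite_support (DirectSum.decompose 𝒜 a)).image Int.ofNat).subset ?_
  intro j hj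
  cases j with
  | negSucc n => exact (hj rfl).elim
  | ofNat n =>
    refine ⟨n, fun h => hj ?_, rfl⟩
    change ((DirectSum.decompose 𝒜 a n : 𝒜 n) : A) = 0
    rw [h]; rfl

theorem eq_zero_of_intProj {a : A} (h : ∀ j, intProj 𝒜 j a = 0) : a = 0 := by
  rw [← (DirectSum.decomposeAddEquiv 𝒜).map_eq_zero_iff]
  ext n
  exact h n

theorem mul_mem_intPiece {i : ℕ} {j : ℤ} {a b : A} (ha : a ∈ 𝒜 i) (hb : b ∈ intPiece 𝒜 j) :
    a * b ∈ intPiece 𝒜 (i + j) := by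
  cases j with
  | ofNat n => exact SetLike.mul_mem_graded (A := 𝒜) ha hb
  | negSucc n => rw [(AddSubgroup.mem_bot).1 hb, mul_zero]; exact zero_mem _

variable (𝒜) in
/-- The graded free module with a basis of elements of the given degrees. -/
noncomputable def free {X : Type u} (deg : X → ℤ) : GrMod 𝒜 where
  carrier := X →₀ A
  piece j :=
    { carrier := {φ | ∀ x, φ x ∈ intPiece 𝒜 (j - deg x)}
      zero_mem' := fun x => zero_mem _
      add_mem' := fun hφ hψ x => add_mem (hφ x) (hψ x)
      neg_mem' := fun hφ x => neg_mem (hφ x) }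
  isInternal := by
    classical
    have key : ∀ j (φ : X →₀ A) x, (Finsupp.liftAddHom fun x =>
        (Finsupp.singleAddHom x).comp (intProj 𝒜 (j - deg x))) φ x =
        intProj 𝒜 (j - deg x) (φ x) := by
      intro j φ x
      induction φ using Finsupp.induction_linear with
      | zero => simp
      | add φ ψ hφ hψ => rw [map_add, Finsupp.add_apply, hφ, hψ, Finsupp.add_apply, map_add]
      | single y a =>
        rcases eq_or_ne y x with rfl | h
        · simp
        · simp [Finsupp.single_eq_of_ne h.symm]
    refine DirectSum.isInternal_of_projections _ (fun j => Finsupp.liftAddHom fun x =>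
        (Finsupp.singleAddHom x).comp (intProj 𝒜 (j - deg x))) ?_ ?_ ?_ ?_ ?_
    · intro j φ x
      rw [key]
      exact intProj_mem _ _
    · intro j φ hφ
      ext x
      rw [key, intProj_of_mem (hφ x)]
    · intro i j h φ hφ
      ext x
      rw [key, intProj_of_mem_ne (fun e => h (sub_left_injective e)) (hφ x)]
      rfl
    · intro φ
      refine (φ.support.finite_toSet.biUnion fun x _ =>
        (finite_intProj (𝒜 := 𝒜) (φ x)).preimage
          (f := fun j => j - deg x) sub_left_injective.injOn).subset ?_
      intro j hj
      obtain ⟨x, hx⟩ := DFunLike.ne_iff.1 hj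
      rw [key] at hx
      refine Set.mem_biUnion (x := x) ?_ hx
      rw [Finset.mem_coe, Finsupp.mem_support_iff]
      intro h
      rw [h, map_zero] at hx
      exact hx rfl
    · intro φ hφ
      ext x
      refine eq_zero_of_intProj (𝒜 := 𝒜) fun j => ?_
      have h := DFunLike.congr_fun (hφ (j + deg x)) x
      rwa [key, add_sub_cancel_right] at h
  smul_mem i j a φ ha hφ x := by
    rw [add_sub_assoc]
    exact mul_mem_intPiece ha (hφ x)

variable {X : Type u} (deg : X → ℤ)

theorem single_mem_free (x : X) :
    (Finsupp.single x (1 : A) : X →₀ A) ∈ (free 𝒜 deg).piece (deg x) := by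
  classical
  intro y
  rcases eq_or_ne x y with rfl | h
  · rw [Finsupp.single_eq_same, sub_self]
    exact SetLike.one_mem_graded 𝒜
  · rw [Finsupp.single_eq_of_ne h.symm]; exact zero_mem _

/-- The homomorphism from a graded free module given by the images of the basis elements. -/
noncomputable def freeLift (M : GrMod 𝒜) (m : X → M.carrier) :
    (free 𝒜 deg).carrier →ₗ[A] M.carrier :=
  (Finsupp.linearCombination A m : (X →₀ A) →ₗ[A] M.carrier)

theorem isGradedHom_freeLift (M : GrMod 𝒜) (m : X → M.carrier) (hm : ∀ x, m x ∈ M.piece (deg x)) :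
    IsGradedHom (freeLift deg M m) := by
  intro j φ hφ
  change Finsupp.sum (φ : X →₀ A) (fun x a => a • m x) ∈ _
  refine sum_mem fun x _ => ?_
  have h : ∀ (i : ℤ) (a : A), a ∈ intPiece 𝒜 i → a • m x ∈ M.piece (i + deg x) := by
    intro i a ha
    cases i with
    | ofNat n => exact M.smul_mem n _ a _ ha (hm x)
    | negSucc n => rw [(AddSubgroup.mem_bot).1 ha, zero_smul]; exact zero_mem _
  simpa using h _ _ (hφ x)

theorem freeLift_single (M : GrMod 𝒜) (m : X → M.carrier) (x : X) :
    freeLift deg M m (Finsupp.single x (1 : A) : X →₀ A) = m x := by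
  change Finsupp.linearCombination A m (Finsupp.single x (1 : A)) = m x
  simp

theorem isGradedProjective_free : IsGradedProjective (free 𝒜 deg) := by
  intro M N g f hg hf hs
  have hb : ∀ x, ∃ m ∈ M.piece (deg x), g m = f (Finsupp.single x (1 : A) : X →₀ A) := by
    intro x
    obtain ⟨m, hm⟩ := hs (f (Finsupp.single x (1 : A) : X →₀ A))
    refine ⟨M.proj (deg x) m, M.proj_mem _ _, ?_⟩
    rw [map_proj hg, hm, proj_of_mem (hf _ _ (single_mem_free deg x))]
  choose m hm hgm using hb
  refine ⟨freeLift deg M m, isGradedHom_freeLift deg M m hm, ?_⟩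
  refine Finsupp.lhom_ext' (M := A) (N := N.carrier) fun x => LinearMap.ext_ring ?_
  exact (congrArg g (freeLift_single deg M m x)).trans (hgm x)

/-- Every graded module is a quotient of a graded free module. -/
theorem exists_free_surjective (M : GrMod 𝒜) :
    ∃ (P : GrMod 𝒜) (_ : IsGradedProjective P) (ε : P.carrier →ₗ[A] M.carrier),
      IsGradedHom ε ∧ Function.Surjective ε := by
  let deg : (Σ j, M.piece j) → ℤ := Sigma.fst
  refine ⟨free 𝒜 deg, isGradedProjective_free deg, freeLift deg M fun x => x.2,
    isGradedHom_freeLift deg M _ fun x => x.2.2, ?_⟩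
  rw [← LinearMap.range_eq_top, eq_top_iff]
  rintro m -
  induction m using induction_on with
  | zero => exact zero_mem _
  | homogeneous j x hx => exact ⟨_, freeLift_single deg M _ ⟨j, x, hx⟩⟩
  | add x y hx hy => exact add_mem hx hy

end GrMod

/-! ### Graded projective dimension -/

/-- If graded submodules of graded projective modules are graded projective, then every graded
module has a resolution `0 → K → F → M → 0`. -/
theorem gradedProjDim_le_one [GradedAlgebra 𝒜]
    (H : ∀ (K F : GrMod 𝒜) (i : K.carrier →ₗ[A] F.carrier), IsGradedHom i → Function.Injective i →
      IsGradedProjective F → IsGradedProjective K) (M : GrMod 𝒜) : gradedProjDim M ≤ 1 := by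
  obtain ⟨F, hF, ε, hε, hs⟩ := M.exists_free_surjective
  let K := GrMod.ker ε hε
  let i : K.carrier →ₗ[A] F.carrier := (LinearMap.ker ε).subtype
  have hi : IsGradedHom i := fun j x hx => hx
  have hinj : Function.Injective i := Subtype.val_injective
  let R : GradedProjectiveResolution M :=
    { P := fun n => match n with
        | 0 => F
        | 1 => K
        | _ + 2 => GrMod.zero 𝒜
      projective := fun n => match n with
        | 0 => hF
        | 1 => H K F i hi hinj hF
        | _ + 2 => @IsGradedProjective.of_subsingleton _ _ _ _ _ _ (GrMod.zero 𝒜)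
            (inferInstanceAs (Subsingleton PUnit))
      d := fun n => match n with
        | 0 => i
        | _ + 1 => 0
      d_graded := fun n => match n with
        | 0 => hi
        | _ + 1 => fun _ _ _ => zero_mem _
      ε := ε
      ε_graded := hε
      ε_surjective := hs
      exact_zero := fun x => ⟨fun hx => ⟨⟨x, hx⟩, rfl⟩, by rintro ⟨y, rfl⟩; exact y.2⟩
      exact_succ := fun n => match n with
        | 0 => fun x => ⟨fun hx => ⟨0, by
            rw [map_zero]; exact (hinj (hx.trans (map_zero i).symm)).symm⟩, by
            rintro ⟨y, rfl⟩; exact map_zero i⟩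
        | _ + 1 => fun x => ⟨fun _ => ⟨0, rfl⟩, fun _ => rfl⟩ }
  refine iInf₂_le_of_le 1 ⟨R, fun n hn => ?_⟩ le_rfl
  match n, hn with
  | n + 2, _ => exact inferInstanceAs (Subsingleton PUnit)

theorem isGradedProjective_of_gradedProjDim_eq_zero {M : GrMod 𝒜} (h : gradedProjDim M = 0) :
    IsGradedProjective M := by
  have h1 : gradedProjDim M < 1 := by rw [h]; exact zero_lt_one
  obtain ⟨n, hn⟩ := iInf_lt_iff.1 h1
  obtain ⟨⟨R, hR⟩, hn⟩ := iInf_lt_iff.1 hn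
  have hn : n = 0 := by
    have : (n : ℕ∞) < ((1 : ℕ) : ℕ∞) := hn
    rw [Nat.cast_lt] at this
    omega
  subst hn
  have hsub : Subsingleton (R.P 1).carrier := hR 1 one_pos
  have hinj : Function.Injective R.ε := by
    refine (injective_iff_map_eq_zero _).2 fun x hx => ?_
    obtain ⟨y, rfl⟩ := (R.exact_zero x).1 hx
    rw [Subsingleton.elim y 0, map_zero]
  let e := LinearEquiv.ofBijective R.ε ⟨hinj, R.ε_surjective⟩
  have he : IsGradedHom (e.symm : M.carrier →ₗ[A] (R.P 0).carrier) := by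
    intro j m hm
    have h2 : e.symm m = (R.P 0).proj j (e.symm m) := by
      apply hinj
      rw [GrMod.map_proj R.ε_graded]
      have h3 : R.ε (e.symm m) = m := e.apply_symm_apply m
      rw [h3, GrMod.proj_of_mem hm]
    rw [LinearEquiv.coe_coe, h2]
    exact GrMod.proj_mem _ _ _
  intro X Y g f hg hf hs
  obtain ⟨φ, hφ, hφg⟩ := R.projective 0 X Y g (f ∘ₗ R.ε) hg
    (fun j m hm => hf _ _ (R.ε_graded _ _ hm)) hs
  refine ⟨φ ∘ₗ e.symm, fun j m hm => hφ _ _ (he _ _ hm), ?_⟩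
  ext m
  have := LinearMap.congr_fun hφg (e.symm m)
  refine this.trans (congrArg f ?_)
  exact e.apply_symm_apply m

end GradedModules

namespace BimoduleTensorAlgebra

section Hereditary

variable {k S V : Type u} [Field k] [Ring S] [Algebra k S]
  [AddCommGroup V] [Module k V] [Module S V] [Module Sᵐᵒᵖ V] {𝒱 : ℕ → Submodule k V}

theorem ofRing_mem_grading (s : S) : ofRing k S V s ∈ grading S 𝒱 0 :=
  Submodule.subset_span (IsMonomial.ofRing s)

theorem ofBimodule_mem_grading {n : ℕ} {v : V} (hv : v ∈ 𝒱 n) :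
    ofBimodule k S V v ∈ grading S 𝒱 n :=
  Submodule.subset_span (IsMonomial.ofBimodule n v hv)

/-! ### Splitting graded modules over the semisimple ring `S` -/

variable {X Y : GrMod (grading S 𝒱)}

theorem exists_graded_section [IsSemisimpleRing S]
    {g : X.carrier →ₗ[BimoduleTensorAlgebra k S V] Y.carrier} (hg : IsGradedHom g)
    (hs : Function.Surjective g) :
    ∃ σ : Y.carrier →+ X.carrier, (∀ s y, σ (ofRing k S V s • y) = ofRing k S V s • σ y) ∧
      (∀ j, ∀ y ∈ Y.piece j, σ y ∈ X.piece j) ∧ ∀ y, g (σ y) = y := by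
  let : Module S X.carrier := Module.compHom _ (ofRing k S V).toRingHom
  let : Module S Y.carrier := Module.compHom _ (ofRing k S V).toRingHom
  let g' : X.carrier →ₗ[S] Y.carrier :=
    { g with map_smul' := fun s x => map_smul g (ofRing k S V s) x }
  have := Module.projective_of_isSemisimpleRing S Y.carrier
  obtain ⟨σ, hσ⟩ := Module.projective_lifting_property g' .id hs
  refine ⟨GrMod.homogenize Y X σ.toAddMonoidHom,
    fun s => GrMod.homogenize_smul _ (ofRing_mem_grading s) (fun y => map_smul σ s y),
    fun j y hy => GrMod.homogenize_mem _ hy, fun y => ?_⟩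
  induction y using GrMod.induction_on with
  | zero => simp
  | homogeneous j y hy =>
    rw [GrMod.homogenize_of_mem _ hy, GrMod.map_proj hg]
    have h : g (σ y) = y := LinearMap.congr_fun hσ y
    exact (congrArg _ h).trans (GrMod.proj_of_mem hy)
  | add x y hx hy => rw [map_add, map_add, hx, hy]

theorem exists_graded_retraction [IsSemisimpleRing S]
    {g : X.carrier →ₗ[BimoduleTensorAlgebra k S V] Y.carrier} (hg : IsGradedHom g)
    (hi : Function.Injective g) :
    ∃ π : Y.carrier →+ X.carrier, (∀ s y, π (ofRing k S V s • y) = ofRing k S V s • π y) ∧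
      (∀ j, ∀ y ∈ Y.piece j, π y ∈ X.piece j) ∧ ∀ x, π (g x) = x := by
  let : Module S X.carrier := Module.compHom _ (ofRing k S V).toRingHom
  let : Module S Y.carrier := Module.compHom _ (ofRing k S V).toRingHom
  let g' : X.carrier →ₗ[S] Y.carrier :=
    { g with map_smul' := fun s x => map_smul g (ofRing k S V s) x }
  obtain ⟨π, hπ⟩ := IsSemisimpleModule.extension_property g' hi .id
  refine ⟨GrMod.homogenize Y X π.toAddMonoidHom,
    fun s => GrMod.homogenize_smul _ (ofRing_mem_grading s) (fun y => map_smul π s y),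
    fun j y hy => GrMod.homogenize_mem _ hy, fun x => ?_⟩
  induction x using GrMod.induction_on with
  | zero => simp
  | homogeneous j x hx =>
    rw [GrMod.homogenize_of_mem _ (hg _ _ hx)]
    have h : π (g x) = x := LinearMap.congr_fun hπ x
    exact (congrArg _ h).trans (GrMod.proj_of_mem hx)
  | add x y hx hy => rw [map_add, map_add, hx, hy]

/-! ### Graded submodules of graded projective modules -/

section twistGrMod

variable {F : GrMod (grading S 𝒱)} [Module k X.carrier]
  [IsScalarTower k (BimoduleTensorAlgebra k S V) X.carrier] [Module k F.carrier]
  [IsScalarTower k (BimoduleTensorAlgebra k S V) F.carrier]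
  (c : V →ₗ[k] F.carrier →ₗ[k] X.carrier)
  (hl : ∀ s v p, c (s • v) p = ofRing k S V s • c v p)
  (hr : ∀ s v p, c (MulOpposite.op s • v) p = c v (ofRing k S V s • p))

theorem twist_mem
    (hc : ∀ n, ∀ v ∈ 𝒱 n, ∀ j, ∀ p ∈ F.piece j, c v p ∈ X.piece (n + j))
    {i : ℕ} {a : BimoduleTensorAlgebra k S V} (ha : a ∈ grading S 𝒱 i) {j : ℤ}
    {y : X.carrier × F.carrier} (h1 : y.1 ∈ X.piece j) (h2 : y.2 ∈ F.piece j) :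
    (twist c hl hr a y).1 ∈ X.piece (i + j) := by
  induction ha using Submodule.span_induction with
  | mem a ha =>
    induction ha generalizing y j with
    | ofRing s =>
      rw [twist_ofRing]
      exact X.smul_mem _ _ _ _ (ofRing_mem_grading s) h1
    | ofBimodule n v hv =>
      rw [twist_ofBimodule]
      exact add_mem (X.smul_mem _ _ _ _ (ofBimodule_mem_grading hv) h1) (hc n v hv j _ h2)
    | mul m n a b ha hb iha ihb =>
      rw [map_mul, Module.End.mul_apply, Nat.cast_add, add_assoc]
      refine iha (ihb h1 h2) ?_
      rw [twist_snd]
      exact F.smul_mem _ _ _ _ (Submodule.subset_span hb) h2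
  | zero => simp
  | add a b _ _ ha hb => rw [map_add]; exact add_mem ha hb
  | smul r a _ ha =>
    have h : (twist c hl hr (r • a) y).1 = algebraMap k (BimoduleTensorAlgebra k S V) r •
        (twist c hl hr a y).1 := by
      rw [map_smul, algebraMap_smul]; rfl
    rw [h, ← AlgHom.commutes (ofRing k S V)]
    simpa using X.smul_mem _ _ _ _ (ofRing_mem_grading (algebraMap k S r)) ha

variable (hc : ∀ n, ∀ v ∈ 𝒱 n, ∀ j, ∀ p ∈ F.piece j, c v p ∈ X.piece (n + j))

/-- The extension of `F` by `X` given by `twist`, as a graded module. -/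
noncomputable def twistGrMod : GrMod (grading S 𝒱) where
  carrier := X.carrier × F.carrier
  module := Module.compHom _ (twist c hl hr).toRingHom
  piece j := (X.piece j).prod (F.piece j)
  isInternal := DirectSum.isInternal_of_projections _ (fun j => (X.proj j).prodMap (F.proj j))
    (fun j y => ⟨X.proj_mem j _, F.proj_mem j _⟩)
    (fun j y hy => Prod.ext (GrMod.proj_of_mem hy.1) (GrMod.proj_of_mem hy.2))
    (fun i j h y hy => Prod.ext (GrMod.proj_of_mem_ne h hy.1) (GrMod.proj_of_mem_ne h hy.2))
    (fun y => ((X.finite_proj y.1).union (F.finite_proj y.2)).subset fun j hj => by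
      by_contra h
      simp only [Set.mem_union, Set.mem_ofPred_eq, not_or, not_not] at h
      exact hj (Prod.ext h.1 h.2))
    (fun y h => Prod.ext (GrMod.eq_zero_of_proj fun j => congrArg Prod.fst (h j))
      (GrMod.eq_zero_of_proj fun j => congrArg Prod.snd (h j)))
  smul_mem i j a y ha hy := by
    refine ⟨twist_mem c hl hr hc ha hy.1 hy.2, ?_⟩
    change (twist c hl hr a y).2 ∈ _
    rw [twist_snd]
    exact F.smul_mem _ _ _ _ ha hy.2

end twistGrMod

/-- `T_S(V)` is graded hereditary. Let `g : X → Y` be surjective, `f : K → Y`, `i : K → F`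
injective. Choose an `S`-linear section `σ` of `g` and an `S`-linear retraction `π` of `i`. The
failure of `σ f π` to be linear is the cocycle `c(v, p) = σ(f(π(v p)) - v f(π p))`, which vanishes
on `K`; as `F` is projective, the extension of `F` by `X` defined by `c` splits, so that there is
`θ : F → X` with the same failure. Then `θ` is linear on `K`, the map `δ = g θ - f π` is linear
on `F`, and subtracting a lift of `δ` from `θ` gives a lift of `f`. -/
theorem isGradedProjective_of_injective [IsSemisimpleRing S] [IsScalarTower k S V]
    [IsScalarTower k Sᵐᵒᵖ V] {K F : GrMod (grading S 𝒱)}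
    (i : K.carrier →ₗ[BimoduleTensorAlgebra k S V] F.carrier) (hi : IsGradedHom i)
    (hinj : Function.Injective i) (hF : IsGradedProjective F) : IsGradedProjective K := by
  intro X Y g f hg hf hs
  obtain ⟨σ, hσS, hσ, hgσ⟩ := exists_graded_section hg hs
  obtain ⟨π, hπS, hπ, hπi⟩ := exists_graded_retraction hi hinj
  let : Module k X.carrier := Module.compHom _ (algebraMap k (BimoduleTensorAlgebra k S V))
  let : Module k F.carrier := Module.compHom _ (algebraMap k (BimoduleTensorAlgebra k S V))
  have : IsScalarTower k (BimoduleTensorAlgebra k S V) X.carrier :=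
    ⟨fun r a m => by rw [Algebra.smul_def, mul_smul]; rfl⟩
  have : IsScalarTower k (BimoduleTensorAlgebra k S V) F.carrier :=
    ⟨fun r a m => by rw [Algebra.smul_def, mul_smul]; rfl⟩
  have hkX : ∀ (r : k) (x : X.carrier), r • x = ofRing k S V (algebraMap k S r) • x :=
    fun r x => by rw [AlgHom.commutes]; rfl
  have hkF : ∀ (r : k) (x : F.carrier), r • x = ofRing k S V (algebraMap k S r) • x :=
    fun r x => by rw [AlgHom.commutes]; rfl
  let c₀ : V → F.carrier → X.carrier := fun v p =>
    σ (f (π (ofBimodule k S V v • p)) - ofBimodule k S V v • f (π p))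
  have hl : ∀ s v p, c₀ (s • v) p = ofRing k S V s • c₀ v p := by
    intro s v p
    simp only [c₀, ofBimodule_smul, mul_smul, hπS, map_smul, ← smul_sub, hσS]
  have hr : ∀ s v p, c₀ (MulOpposite.op s • v) p = c₀ v (ofRing k S V s • p) := by
    intro s v p
    simp only [c₀, ofBimodule_op_smul, mul_smul, hπS, map_smul]
  let c : V →ₗ[k] F.carrier →ₗ[k] X.carrier := LinearMap.mk₂ k c₀
    (by
      intro v w p
      simp only [c₀, ← σ.map_add]
      congr 1
      simp only [map_add, add_smul]
      abel)
    (by intro r v p; rw [← algebraMap_smul S r v, hl, hkX])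
    (by
      intro v p q
      simp only [c₀, ← σ.map_add]
      congr 1
      simp only [map_add, smul_add]
      abel)
    (by
      intro r v p
      rw [hkF, ← hr, hkX, ← hl, algebraMap_smul, ← MulOpposite.algebraMap_apply, algebraMap_smul])
  have hl : ∀ s v p, c (s • v) p = ofRing k S V s • c v p := hl
  have hr : ∀ s v p, c (MulOpposite.op s • v) p = c v (ofRing k S V s • p) := hr
  have hc : ∀ n, ∀ v ∈ 𝒱 n, ∀ j, ∀ p ∈ F.piece j, c v p ∈ X.piece (n + j) := by
    intro n v hv j p hp
    have hv' := ofBimodule_mem_grading (S := S) hv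
    exact hσ _ _ (sub_mem (hf _ _ (hπ _ _ (F.smul_mem _ _ _ _ hv' hp)))
      (Y.smul_mem _ _ _ _ hv' (hf _ _ (hπ _ _ hp))))
  let G := twistGrMod c hl hr hc
  have hG : ∀ (a : BimoduleTensorAlgebra k S V) (y : G.carrier), a • y = twist c hl hr a y :=
    fun a y => rfl
  let snd : G.carrier →ₗ[BimoduleTensorAlgebra k S V] F.carrier :=
    { toFun := fun y => Prod.snd (y : X.carrier × F.carrier)
      map_add' := fun y z => rfl
      map_smul' := fun a y => twist_snd c hl hr a y }
  obtain ⟨h, hh, hsnd⟩ := hF G F snd .id (fun j y hy => hy.2) (fun j y hy => hy)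
    (fun p => ⟨((0, p) : X.carrier × F.carrier), rfl⟩)
  let θ : F.carrier →+ X.carrier := (AddMonoidHom.fst X.carrier F.carrier).comp h.toAddMonoidHom
  have hθ : ∀ a p, θ (a • p) = (twist c hl hr a (θ p, p)).1 := by
    intro a p
    have h1 : (h p : X.carrier × F.carrier) = (θ p, p) :=
      Prod.ext rfl (LinearMap.congr_fun hsnd p)
    change Prod.fst (h (a • p) : X.carrier × F.carrier) = _
    rw [map_smul, hG, h1]
  have hθK : ∀ (a : BimoduleTensorAlgebra k S V) (x : K.carrier), θ (i (a • x)) = a • θ (i x) := by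
    intro a x
    rw [map_smul, hθ]
    refine twist_fst_of_mem c hl hr (LinearMap.range i) ?_ a _ ⟨x, rfl⟩
    rintro v _ ⟨y, rfl⟩
    change σ (f (π (ofBimodule k S V v • i y)) - ofBimodule k S V v • f (π (i y))) = 0
    rw [← map_smul, hπi, hπi, map_smul, sub_self, map_zero]
  have hδ : ∀ (a : BimoduleTensorAlgebra k S V) (p : F.carrier),
      g (θ (a • p)) - f (π (a • p)) = a • (g (θ p) - f (π p)) := by
    intro a
    induction a using induction_on with
    | ring s =>
      intro p
      rw [hθ, twist_ofRing, hπS]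
      simp [smul_sub]
    | bimodule v =>
      intro p
      rw [hθ, twist_ofBimodule]
      change g (ofBimodule k S V v • θ p +
        σ (f (π (ofBimodule k S V v • p)) - ofBimodule k S V v • f (π p))) - _ = _
      rw [map_add, hgσ, map_smul, smul_sub]
      abel
    | add a b ha hb =>
      intro p
      rw [add_smul, add_smul, ← ha, ← hb]
      simp only [map_add]
      abel
    | mul a b ha hb => intro p; rw [mul_smul, ha, hb, mul_smul]
  let δ : F.carrier →ₗ[BimoduleTensorAlgebra k S V] Y.carrier :=
    { (g.toAddMonoidHom.comp θ - f.toAddMonoidHom.comp π) with map_smul' := hδ }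
  have hδg : IsGradedHom δ := fun j p hp =>
    sub_mem (hg _ _ (hh _ _ hp).1) (hf _ _ (hπ _ _ hp))
  obtain ⟨δ', hδ'g, hδ'⟩ := hF X Y g δ hg hδg hs
  let θK : K.carrier →ₗ[BimoduleTensorAlgebra k S V] X.carrier :=
    { θ.comp i.toAddMonoidHom with map_smul' := hθK }
  refine ⟨θK - δ' ∘ₗ i, fun j x hx => sub_mem (hh _ _ (hi _ _ hx)).1 (hδ'g _ _ (hi _ _ hx)), ?_⟩
  ext x
  have h1 : g (δ' (i x)) = g (θ (i x)) - f (π (i x)) := LinearMap.congr_fun hδ' (i x)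
  change g (θ (i x) - δ' (i x)) = f x
  rw [map_sub, h1, hπi]
  abel

end Hereditary

/-! ### The graded Jacobson radical -/

section Radical

variable {k S V : Type u} [Field k] [Ring S] [Algebra k S]
  [AddCommGroup V] [Module k V] [Module S V] [Module Sᵐᵒᵖ V] {𝒱 : ℕ → Submodule k V}

theorem augmentation_eq_zero_of_mem_grading {n : ℕ} (hn : n ≠ 0) {x : BimoduleTensorAlgebra k S V}
    (hx : x ∈ grading S 𝒱 n) : augmentation k S V x = 0 := by
  induction hx using Submodule.span_induction with
  | mem x hx =>
    induction hx with
    | ofRing s => exact (hn rfl).elim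
    | ofBimodule n v hv => exact augmentation_ofBimodule v
    | mul m n x y _ _ ihx ihy =>
      rw [map_mul]
      rcases Nat.eq_zero_or_pos m with hm | hm
      · rw [ihy (by omega), mul_zero]
      · rw [ihx hm.ne', zero_mul]
  | zero => exact map_zero _
  | add x y _ _ hx hy => rw [map_add, hx, hy, add_zero]
  | smul r x _ hx => rw [map_smul, hx, smul_zero]

theorem mul_mem_grading_zero {x y : BimoduleTensorAlgebra k S V} (hx : x ∈ grading S 𝒱 0)
    (hy : y ∈ grading S 𝒱 0) : x * y ∈ grading S 𝒱 0 := by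
  have h := SetLike.mul_mem_graded (A := grading S 𝒱) hx hy
  rwa [add_zero] at h

/-- Right multiplication by `a` is injective on the finite-dimensional degree zero part. -/
theorem exists_mul_eq_one_of_augmentation_eq_one [Module.Finite k (grading S 𝒱 0)]
    {a : BimoduleTensorAlgebra k S V} (ha : a ∈ grading S 𝒱 0) (h : augmentation k S V a = 1) :
    ∃ b, b * a = 1 ∧ a * b = 1 := by
  have key : ∀ a ∈ grading S 𝒱 0, augmentation k S V a = 1 → ∃ b ∈ grading S 𝒱 0, b * a = 1 := by
    intro a ha h
    let R : grading S 𝒱 0 →ₗ[k] grading S 𝒱 0 :=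
      { toFun := fun x => ⟨x * a, mul_mem_grading_zero x.2 ha⟩
        map_add' := fun x y => Subtype.ext (add_mul _ _ _)
        map_smul' := fun r x => Subtype.ext (smul_mul_assoc r (x : BimoduleTensorAlgebra k S V) a) }
    have hR : Function.Injective R := by
      refine (injective_iff_map_eq_zero _).2 fun x hx => Subtype.ext ?_
      have hx : (x : BimoduleTensorAlgebra k S V) * a = 0 := congrArg Subtype.val hx
      refine eq_zero_of_mul_eq_self (y := 1 - a) ?_ ?_
      · rw [RingHom.mem_ker, map_sub, map_one, h, sub_self]
      · rw [mul_sub, mul_one, hx, sub_zero]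
    obtain ⟨b, hb⟩ := LinearMap.injective_iff_surjective.1 hR ⟨1, SetLike.one_mem_graded _⟩
    exact ⟨b, b.2, congrArg Subtype.val hb⟩
  obtain ⟨b, hb, hba⟩ := key a ha h
  have hεb : augmentation k S V b = 1 := by
    have := congrArg (augmentation k S V) hba
    rwa [map_mul, h, mul_one, map_one] at this
  obtain ⟨c, -, hcb⟩ := key b hb hεb
  have hca : c = a := by rw [← mul_one c, ← hba, ← mul_assoc, hcb, one_mul]
  exact ⟨b, hba, hca ▸ hcb⟩

variable [DirectSum.Decomposition 𝒱] [IsGradedBimodule (S := S) 𝒱]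

theorem augmentation_decompose_zero (x : BimoduleTensorAlgebra k S V) :
    augmentation k S V (DirectSum.decompose (grading S 𝒱) x 0) = augmentation k S V x := by
  induction x using DirectSum.Decomposition.inductionOn (grading S 𝒱) with
  | zero => simp
  | add x y hx hy =>
    rw [DirectSum.decompose_add, DirectSum.add_apply, Submodule.coe_add, map_add, hx, hy, map_add]
  | @homogeneous n x =>
    rcases eq_or_ne n 0 with rfl | hn
    · rw [DirectSum.decompose_of_mem_same _ x.2]
    · rw [DirectSum.decompose_of_mem_ne _ x.2 hn, map_zero,
        augmentation_eq_zero_of_mem_grading hn x.2]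

theorem isHomogeneous_comap_augmentation (I : Ideal S) :
    (I.comap (augmentation k S V)).IsHomogeneous (grading S 𝒱) := by
  intro n x hx
  rw [Ideal.mem_comap] at hx ⊢
  rcases eq_or_ne n 0 with rfl | hn
  · rwa [augmentation_decompose_zero]
  · rw [augmentation_eq_zero_of_mem_grading hn (DirectSum.decompose (grading S 𝒱) x n).2]
    exact zero_mem _

theorem augIdeal_le_of_isMaximalHomogeneous [Module.Finite k (grading S 𝒱 0)]
    {I : Ideal (BimoduleTensorAlgebra k S V)} (hI : IsMaximalHomogeneous (grading S 𝒱) I) :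
    augIdeal k S V ≤ I := by
  by_contra hle
  have hJ : (augIdeal k S V).IsHomogeneous (grading S 𝒱) := by
    have := isHomogeneous_comap_augmentation (k := k) (V := V) (𝒱 := 𝒱) (⊥ : Ideal S)
    rwa [← RingHom.ker_eq_comap_bot] at this
  have htop := hI.2.2 _ (hI.1.sup hJ) (left_lt_sup.2 hle)
  obtain ⟨a, ha, j, hj, haj⟩ := Submodule.mem_sup.1
    (htop ▸ Submodule.mem_top : (1 : BimoduleTensorAlgebra k S V) ∈ I ⊔ augIdeal k S V)
  obtain ⟨b, hb, -⟩ := exists_mul_eq_one_of_augmentation_eq_one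
    (DirectSum.decompose (grading S 𝒱) a 0).2 (by
      rw [augmentation_decompose_zero, ← map_one (augmentation k S V), ← haj, map_add,
        RingHom.mem_ker.1 hj, add_zero])
  refine hI.2.1 ((Ideal.eq_top_iff_one I).2 ?_)
  rw [← hb]
  exact I.mul_mem_left _ (hI.1 0 ha)

variable [IsSemisimpleRing S] [Module.Finite k (grading S 𝒱 0)]

variable (𝒱) in
/-- The graded Jacobson radical of `T_S(V)` is the augmentation ideal. -/
theorem gradedJacobson_eq_augIdeal : gradedJacobson (grading S 𝒱) = augIdeal k S V := by
  apply le_antisymm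
  · have hS : Ring.jacobson S = ⊥ := IsSemisimpleModule.jacobson_eq_bot S S
    intro x hx
    rw [RingHom.mem_ker, ← Ideal.mem_bot, ← hS, Ring.jacobson, Module.jacobson, Submodule.mem_sInf]
    intro 𝔪 h𝔪
    have hcomap : IsMaximalHomogeneous (grading S 𝒱) (Ideal.comap (augmentation k S V) 𝔪) := by
      refine ⟨isHomogeneous_comap_augmentation 𝔪, fun h => h𝔪.1 ?_, fun I hI hlt => ?_⟩
      · rw [Ideal.eq_top_iff_one, ← map_one (augmentation k S V), ← Ideal.mem_comap, h]
        trivial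
      · obtain ⟨c, hcI, hc⟩ := SetLike.exists_of_lt hlt
        have htop : 𝔪 ⊔ Ideal.span {augmentation k S V c} = ⊤ := by
          refine h𝔪.2 _ (left_lt_sup.2 fun hle => hc ?_)
          exact hle (Ideal.mem_span_singleton_self _)
        obtain ⟨m, hm, y, hy, hmy⟩ := Submodule.mem_sup.1
          (htop ▸ Submodule.mem_top : (1 : S) ∈ 𝔪 ⊔ Ideal.span {augmentation k S V c})
        obtain ⟨z, rfl⟩ := Ideal.mem_span_singleton'.1 hy
        have h1 : 1 - ofRing k S V z * c ∈ Ideal.comap (augmentation k S V) 𝔪 := by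
          rw [Ideal.mem_comap, map_sub, map_one, map_mul, augmentation_ofRing, ← hmy,
            add_sub_cancel_right]
          exact hm
        rw [Ideal.eq_top_iff_one]
        simpa using I.add_mem (hlt.le h1) (I.mul_mem_left (ofRing k S V z) hcI)
    exact Submodule.mem_sInf.1 hx _ hcomap
  · exact le_sInf fun I hI => augIdeal_le_of_isMaximalHomogeneous hI

variable (𝒱) in
theorem ofBimodule_mem_gradedJacobson (v : V) :
    ofBimodule k S V v ∈ gradedJacobson (grading S 𝒱) :=
  gradedJacobson_eq_augIdeal (S := S) 𝒱 ▸ ofBimodule_mem_augIdeal v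

end Radical

/-! ### The graded global dimension -/

section GlobalDimension

variable {k S V : Type u} [Field k] [Ring S] [Algebra k S]
  [AddCommGroup V] [Module k V] [Module S V] [Module Sᵐᵒᵖ V]

variable (S) in
/-- The ring `S` as a graded `T_S(V)`-module in degree `0`. -/
noncomputable def trivialGrMod (𝒱 : ℕ → Submodule k V) : GrMod (grading S 𝒱) where
  carrier := S
  module := Module.compHom S (augmentation k S V).toRingHom
  piece j := if j = 0 then ⊤ else ⊥
  isInternal := DirectSum.isInternal_of_projections _
    (fun j => if j = 0 then AddMonoidHom.id S else 0)
    (fun j x => by split_ifs <;> simp)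
    (fun j x hx => by
      split_ifs at hx ⊢
      · rfl
      · exact ((AddSubgroup.mem_bot).1 hx).symm)
    (fun i j h x hx => by
      by_cases hj : j = 0
      · have hi : i ≠ 0 := fun hi => h (hi.trans hj.symm)
        rw [if_neg hi] at hx
        rw [(AddSubgroup.mem_bot).1 hx, map_zero]
      · rw [if_neg hj]; rfl)
    (fun x => (Set.finite_singleton (0 : ℤ)).subset fun j hj => by
      by_contra h
      have h : j ≠ 0 := h
      exact hj (by rw [if_neg h]; rfl))
    (fun x h => by simpa using h 0)
  smul_mem i j a m ha hm := by
    change augmentation k S V a * m ∈ _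
    rcases eq_or_ne i 0 with rfl | hi
    · rw [Nat.cast_zero, zero_add]
      split_ifs at hm ⊢
      · trivial
      · rw [(AddSubgroup.mem_bot).1 hm, mul_zero]; exact zero_mem _
    · rw [augmentation_eq_zero_of_mem_grading hi ha, zero_mul]
      exact zero_mem _

variable (𝒱 : ℕ → Submodule k V) [DirectSum.Decomposition 𝒱] [IsGradedBimodule (S := S) 𝒱]

theorem gradedGlobalDim_le_one [IsScalarTower k S V] [IsScalarTower k Sᵐᵒᵖ V]
    [IsSemisimpleRing S] : gradedGlobalDim (grading S 𝒱) ≤ 1 :=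
  iSup_le fun M => gradedProjDim_le_one
    (fun _ _ i hi hinj hF => isGradedProjective_of_injective i hi hinj hF) M

/-- If `V ≠ 0`, then `S` is not graded projective: a splitting of `T_S(V) → S` would give an
element `a` of degree `0` with augmentation `1` and `V a = 0`, but such an `a` is invertible. -/
theorem gradedGlobalDim_ne_zero [SMulCommClass S Sᵐᵒᵖ V] [IsScalarTower k S V]
    [IsScalarTower k Sᵐᵒᵖ V] [Module.Finite k (grading S 𝒱 0)]
    [Nontrivial V] :
    gradedGlobalDim (grading S 𝒱) ≠ 0 := by
  intro h
  have hP : IsGradedProjective (trivialGrMod S 𝒱) :=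
    isGradedProjective_of_gradedProjDim_eq_zero
      (nonpos_iff_eq_zero.1 ((le_iSup _ _).trans h.le))
  let F := GrMod.free (grading S 𝒱) fun _ : PUnit.{u + 1} => 0
  let M := trivialGrMod S 𝒱
  let e : M.carrier := (1 : S)
  have he : e ∈ M.piece 0 := AddSubgroup.mem_top _
  have hsmul : ∀ (a : BimoduleTensorAlgebra k S V), a • e = augmentation k S V a :=
    fun a => mul_one (augmentation k S V a)
  let p : F.carrier →ₗ[BimoduleTensorAlgebra k S V] M.carrier := GrMod.freeLift _ M fun _ => e
  have hp : ∀ φ : PUnit.{u + 1} →₀ BimoduleTensorAlgebra k S V,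
      p φ = augmentation k S V (φ PUnit.unit) := by
    intro φ
    change Finsupp.linearCombination (BimoduleTensorAlgebra k S V) (fun _ : PUnit => e) φ = _
    rw [Finsupp.linearCombination_unique]
    exact hsmul _
  obtain ⟨σ, hσ, hpσ⟩ := hP F M p .id (GrMod.isGradedHom_freeLift _ M _ fun _ => he)
    (fun _ _ hm => hm) fun s => by
      refine ⟨Finsupp.single PUnit.unit (ofRing k S V s), (hp _).trans ?_⟩
      rw [Finsupp.single_eq_same]
      exact augmentation_ofRing (S := S) s
  let φ : PUnit.{u + 1} →₀ BimoduleTensorAlgebra k S V := σ e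
  have hφ : φ PUnit.unit ∈ grading S 𝒱 0 := hσ 0 e he PUnit.unit
  have hε : augmentation k S V (φ PUnit.unit) = 1 :=
    (hp φ).symm.trans (LinearMap.congr_fun hpσ e)
  obtain ⟨b, -, hb⟩ := exists_mul_eq_one_of_augmentation_eq_one hφ hε
  obtain ⟨v, hv⟩ := exists_ne (0 : V)
  have h1 : ofBimodule k S V v • e = 0 := (hsmul _).trans (augmentation_ofBimodule (S := S) v)
  have h2 : ofBimodule k S V v • σ e = 0 := by rw [← map_smul, h1, map_zero]
  have h3 : ofBimodule k S V v * φ PUnit.unit = 0 :=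
    congrArg (fun ψ : PUnit.{u + 1} →₀ BimoduleTensorAlgebra k S V => ψ PUnit.unit) h2
  refine hv (ofBimodule_injective (k := k) (S := S) ?_)
  rw [map_zero, ← mul_one (ofBimodule k S V v), ← hb, ← mul_assoc, h3, zero_mul]

end GlobalDimension

end BimoduleTensorAlgebra

/-! ### Invertible bimodules -/

section Invertible

/-- The Morita-theoretic criterion for invertibility of a bimodule `V` over a semisimple ring: every
left `S`-linear endomorphism of `V` is right multiplication by a unique element of `S`, and `V` is
a generator of the category of left `S`-modules. -/
structure IsMoritaBimodule (S V : Type u) [Ring S] [AddCommGroup V] [Module S V] [Module Sᵐᵒᵖ V] :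
    Prop where
  faithful : ∀ s : S, (∀ v : V, MulOpposite.op s • v = 0) → s = 0
  exists_endo_eq : ∀ φ : V →ₗ[S] V, ∃ s : S, ∀ v, φ v = MulOpposite.op s • v
  generator : Submodule.span S {s : S | ∃ (f : V →ₗ[S] S) (v : V), f v = s} = ⊤

variable {k S V : Type u} [Field k] [Ring S] [AddCommGroup V] [Module k V] [Module Sᵐᵒᵖ V]

theorem balancedTensor_induction {W : Type u} [AddCommGroup W] [Module k W] [Module S W]
    {C : BalancedTensor k S V W → Prop} (x : BalancedTensor k S V W) (zero : C 0)
    (tmul : ∀ v w, C (balancedTmul k S v w)) (add : ∀ x y, C x → C y → C (x + y)) : C x := by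
  obtain ⟨x, rfl⟩ := Submodule.mkQ_surjective _ x
  induction x using TensorProduct.induction_on with
  | zero => rwa [map_zero]
  | tmul v w => exact tmul v w
  | add x y hx hy => rw [map_add]; exact add _ _ hx hy

section tmul

variable {W : Type u} [AddCommGroup W] [Module k W] [Module S W]

theorem balancedTmul_add (v : V) (w w' : W) :
    balancedTmul k S v (w + w') = balancedTmul k S v w + balancedTmul k S v w' := by
  simp only [balancedTmul, TensorProduct.tmul_add, map_add]

theorem add_balancedTmul (v v' : V) (w : W) :
    balancedTmul k S (v + v') w = balancedTmul k S v w + balancedTmul k S v' w := by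
  simp only [balancedTmul, TensorProduct.add_tmul, map_add]

theorem zero_balancedTmul (w : W) : balancedTmul k S (0 : V) w = 0 := by
  rw [balancedTmul, TensorProduct.zero_tmul, map_zero]

theorem sum_balancedTmul {ι : Type*} (t : Finset ι) (v : ι → V) (w : W) :
    balancedTmul k S (∑ i ∈ t, v i) w = ∑ i ∈ t, balancedTmul k S (v i) w := by
  simp only [balancedTmul, TensorProduct.sum_tmul, map_sum]

theorem balancedTmul_smul (s : S) (v : V) (w : W) :
    balancedTmul k S v (s • w) = balancedTmul k S (MulOpposite.op s • v) w := by
  rw [eq_comm, ← sub_eq_zero, balancedTmul, balancedTmul, ← map_sub, Submodule.mkQ_apply,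
    Submodule.Quotient.mk_eq_zero]
  exact Submodule.subset_span ⟨v, s, w, rfl⟩

/-- The map out of `V ⊗_S W` induced by a balanced bilinear map. -/
noncomputable def balancedLift {M : Type u} [AddCommGroup M] [Module k M] (b : V →ₗ[k] W →ₗ[k] M)
    (hb : ∀ v (s : S) w, b (MulOpposite.op s • v) w = b v (s • w)) :
    BalancedTensor k S V W →ₗ[k] M :=
  (balancedRelations k S V W).liftQ (TensorProduct.lift b) (by
    rw [balancedRelations, Submodule.span_le]
    rintro _ ⟨v, s, w, rfl⟩
    rw [SetLike.mem_coe, LinearMap.mem_ker, map_sub, TensorProduct.lift.tmul,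
      TensorProduct.lift.tmul, hb, sub_self])

@[simp] theorem balancedLift_tmul {M : Type u} [AddCommGroup M] [Module k M]
    (b : V →ₗ[k] W →ₗ[k] M) (hb : ∀ v (s : S) w, b (MulOpposite.op s • v) w = b v (s • w))
    (v : V) (w : W) : balancedLift b hb (balancedTmul k S v w) = b v w :=
  TensorProduct.lift.tmul v w

end tmul

variable [Algebra k S] [Module S V]

/-- The bilinear map `V × W → S` underlying an isomorphism `V ⊗_S W ≅ S`. -/
theorem BalancedTensorIsoRing.exists_pairing [IsScalarTower k S V] {W : Type u}
    [AddCommGroup W] [Module k W] [Module S W] [Module Sᵐᵒᵖ W] [IsScalarTower k Sᵐᵒᵖ W]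
    (h : BalancedTensorIsoRing k S V W) :
    ∃ (b : V →ₗ[k] W →ₗ[k] S) (e : BalancedTensor k S V W ≃+ S),
      (∀ v w, e (balancedTmul k S v w) = b v w) ∧
      (∀ (s : S) v w, b (s • v) w = s * b v w) ∧
      (∀ (t : S) v w, b v (MulOpposite.op t • w) = b v w * t) ∧
      (∀ (s : S) v w, b (MulOpposite.op s • v) w = b v (s • w)) ∧
      (∀ C : S → Prop, C 0 → (∀ v w, C (b v w)) → (∀ x y, C x → C y → C (x + y)) → ∀ s, C s) := by
  obtain ⟨e, he⟩ := h
  have h1 : ∀ (s : S) (v : V) (w : W), e (balancedTmul k S (s • v) w) =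
      s * e (balancedTmul k S v w) := fun s v w => by simpa using he s 1 v w
  have h2 : ∀ (t : S) (v : V) (w : W), e (balancedTmul k S v (MulOpposite.op t • w)) =
      e (balancedTmul k S v w) * t := fun t v w => by simpa using he 1 t v w
  refine ⟨LinearMap.mk₂ k (fun v w => e (balancedTmul k S v w)) ?_ ?_ ?_ ?_, e,
    fun v w => rfl, h1, h2, ?_, ?_⟩
  · intro v v' w; rw [add_balancedTmul, map_add]
  · intro r v w; rw [← algebraMap_smul S r v, h1, Algebra.smul_def]
  · intro v w w'; rw [balancedTmul_add, map_add]
  · intro r v w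
    rw [← algebraMap_smul Sᵐᵒᵖ r w, MulOpposite.algebraMap_apply, h2, Algebra.smul_def,
      Algebra.commutes]
  · intro s v w
    exact congrArg e (balancedTmul_smul s v w).symm
  · intro C h0 hb hadd s
    obtain ⟨x, rfl⟩ := e.surjective s
    induction x using balancedTensor_induction with
    | zero => rwa [map_zero]
    | tmul v w => exact hb v w
    | add x y hx hy => rw [map_add]; exact hadd _ _ hx hy

/-- An invertible bimodule is a generator because of the linear forms given by the elements of its
inverse `W`. An endomorphism `φ` of `V` induces an endomorphism of `W ⊗_S V ≅ S`, which is right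
multiplication by some `s`; then `φ` is right multiplication by `s` because the functor
`W ⊗_S -` is faithful. -/
theorem IsInvertibleBimodule.isMoritaBimodule [SMulCommClass S Sᵐᵒᵖ V] [IsScalarTower k S V]
    [IsScalarTower k Sᵐᵒᵖ V] (h : IsInvertibleBimodule k S V) : IsMoritaBimodule S V := by
  obtain ⟨W, hVW, hWV⟩ := h
  obtain ⟨b, -, -, hb1, hb2, hb3, hb⟩ := BalancedTensorIsoRing.exists_pairing hVW
  obtain ⟨b', e, hb'e, hb'1, hb'2, hb'3, hb'⟩ := BalancedTensorIsoRing.exists_pairing hWV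
  have hone : ∀ v : V, (∀ (w : W.carrier) (v' : V), b v' w • v = 0) → v = 0 := by
    intro v hv
    have := hb (fun s => s • v = 0) (zero_smul _ _) (fun v' w => hv w v')
      (fun x y hx hy => by rw [add_smul, hx, hy, add_zero]) 1
    rwa [one_smul] at this
  refine ⟨fun s hs => ?_, fun φ => ?_, ?_⟩
  · rw [← one_mul s]
    refine hb' (fun t => t * s = 0) (zero_mul _) (fun w v => ?_)
      (fun x y hx hy => by rw [add_mul, hx, hy, add_zero]) 1
    rw [← hb'2, hs, map_zero]
  · let φW : BalancedTensor k S W.carrier V →ₗ[k] BalancedTensor k S W.carrier V := balancedLift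
      (LinearMap.mk₂ k (fun w v => balancedTmul k S w (φ v))
        (fun w w' v => add_balancedTmul _ _ _)
        (fun r w v => by
          simp only [balancedTmul, ← TensorProduct.smul_tmul', map_smul])
        (fun w v v' => by rw [map_add, balancedTmul_add])
        (fun r w v => by
          rw [LinearMap.map_smul_of_tower]
          simp only [balancedTmul, TensorProduct.tmul_smul, map_smul]))
      (fun w s v => by
        change balancedTmul k S _ (φ v) = balancedTmul k S w (φ (s • v))
        rw [map_smul, balancedTmul_smul])
    have hφW : ∀ w v, φW (balancedTmul k S w v) = balancedTmul k S w (φ v) := fun w v =>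
      balancedLift_tmul _ _ w v
    have hlin : ∀ t r, e (φW (e.symm (t * r))) = t * e (φW (e.symm r)) := by
      intro t r
      refine hb' (fun r => e (φW (e.symm (t * r))) = t * e (φW (e.symm r))) (by simp) (fun w v => ?_)
        (fun x y hx hy => by rw [mul_add, map_add, map_add, map_add, hx, hy, map_add, map_add,
          map_add, mul_add]) r
      rw [← hb'1, ← hb'e, ← hb'e, e.symm_apply_apply, e.symm_apply_apply, hφW, hφW, hb'e, hb'e, hb'1]
    refine ⟨e (φW (e.symm 1)), fun v => ?_⟩
    rw [← sub_eq_zero]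
    refine hone _ fun w v' => ?_
    have hw : balancedTmul k S w (φ v) =
        balancedTmul k S w (MulOpposite.op (e (φW (e.symm 1))) • v) := by
      apply e.injective
      have h := hlin (e (balancedTmul k S w v)) 1
      rw [mul_one, e.symm_apply_apply, hφW] at h
      rw [h, hb'e, hb'e, hb'2]
    -- `w ⊗ x ↦ b(v', w) x` is well defined on `W ⊗_S V`
    let B : BalancedTensor k S W.carrier V →ₗ[k] V := balancedLift
      (LinearMap.mk₂ k (fun w x => b v' w • x)
        (fun w w' x => by rw [map_add, add_smul])
        (fun r w x => by rw [map_smul, smul_assoc])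
        (fun w x x' => smul_add _ _ _)
        (fun r w x => smul_comm _ _ _))
      (fun w s x => by
        rw [LinearMap.mk₂_apply, LinearMap.mk₂_apply, hb2, mul_smul])
    have hB : ∀ x, B (balancedTmul k S w x) = b v' w • x := fun x => balancedLift_tmul _ _ w x
    rw [smul_sub, ← hB, ← hB, hw, sub_self]
  · rw [Ideal.eq_top_iff_one]
    refine hb (fun s => s ∈ _) (zero_mem _) (fun v w => ?_) (fun x y hx hy => add_mem hx hy) 1
    refine Submodule.subset_span
      ⟨{ toFun := fun v => b v w, map_add' := ?_, map_smul' := ?_ }, v, rfl⟩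
    · intro v v'; rw [map_add, LinearMap.add_apply]
    · intro s v; exact hb1 s v w

theorem IsMoritaBimodule.induction {C : S → Prop} (h : IsMoritaBimodule S V) (zero : C 0)
    (apply : ∀ (f : V →ₗ[S] S) v, C (f v)) (add : ∀ x y, C x → C y → C (x + y)) (s : S) : C s := by
  have hs : s ∈ (Submodule.span S {s : S | ∃ (f : V →ₗ[S] S) (v : V), f v = s}).toAddSubmonoid := by
    rw [h.generator]; trivial
  rw [Submodule.span_eq_closure] at hs
  induction hs using AddSubmonoid.closure_induction with
  | mem x hx =>
    obtain ⟨a, -, _, ⟨f, v, rfl⟩, rfl⟩ := hx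
    change C (a • f v)
    rw [← map_smul]
    exact apply _ _
  | zero => exact zero
  | add x y _ _ hx hy => exact add _ _ hx hy

/-! ### The dual bimodule -/

section Dual

variable [SMulCommClass S Sᵐᵒᵖ V]

variable (V) in
/-- Right multiplication by `s`, as an endomorphism of the left module `V`. -/
def rightMulEnd (s : S) : V →ₗ[S] V where
  toFun v := MulOpposite.op s • v
  map_add' v w := smul_add _ v w
  map_smul' t v := (smul_comm t (MulOpposite.op s) v).symm

theorem rightMulEnd_apply (s : S) (v : V) : rightMulEnd V s v = MulOpposite.op s • v := rfl

variable (S V) in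
/-- The left action of `S` on `Hom_S(V, S)` induced by the right action on `V`. -/
abbrev dualLeftModule : Module S (V →ₗ[S] S) where
  smul s f := f ∘ₗ rightMulEnd V s
  one_smul f := LinearMap.ext fun v => congrArg f (one_smul Sᵐᵒᵖ v)
  mul_smul s t f := LinearMap.ext fun v => congrArg f (by
    simp only [rightMulEnd_apply, MulOpposite.op_mul, mul_smul])
  smul_zero s := rfl
  smul_add s f g := rfl
  add_smul s t f := LinearMap.ext fun v =>
    (congrArg f (by simp [rightMulEnd_apply, add_smul])).trans (map_add f _ _)
  zero_smul f := LinearMap.ext fun v => (congrArg f (zero_smul Sᵐᵒᵖ v)).trans (map_zero f)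

variable [IsScalarTower k S V] [IsScalarTower k Sᵐᵒᵖ V]

variable (k S V) in
/-- The bimodule `Hom_S(V, S)` of left `S`-linear maps, with `(s f t)(v) = f(v s) t`. -/
noncomputable def dualBimodule : CentralBimodule k S :=
  let : Module S (V →ₗ[S] S) := dualLeftModule S V
  { carrier := V →ₗ[S] S
    comm := ⟨fun s t f => rfl⟩
    towl := ⟨fun r s f => LinearMap.ext fun v => by
      change f (MulOpposite.op (r • s) • v) = r • f (MulOpposite.op s • v)
      rw [MulOpposite.op_smul, smul_assoc, LinearMap.map_smul_of_tower]⟩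
    towr := inferInstance }

/-- The evaluation `V ⊗_S Hom_S(V, S) → S` is an isomorphism. -/
theorem IsMoritaBimodule.balancedTensorIsoRing_dual (h : IsMoritaBimodule S V) :
    BalancedTensorIsoRing k S V (dualBimodule k S V).carrier := by
  let D := dualBimodule k S V
  let toMap : D.carrier ≃ₗ[k] (V →ₗ[S] S) := LinearEquiv.refl k _
  let ev : BalancedTensor k S V D.carrier →ₗ[k] S := balancedLift
    (LinearMap.mk₂ k (fun v (f : D.carrier) => toMap f v)
      (fun v w f => map_add (toMap f) v w)
      (fun r v f => LinearMap.map_smul_of_tower (toMap f) r v)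
      (fun v f g => rfl)
      (fun r v f => rfl))
    (fun v s f => rfl)
  have hev : ∀ v f, ev (balancedTmul k S v f) = toMap f v := fun v f => balancedLift_tmul _ _ v f
  -- right multiplication by `t` on `V ⊗ Hom(V, S)`
  let R : S → BalancedTensor k S V D.carrier →ₗ[k] BalancedTensor k S V D.carrier := fun t =>
    balancedLift
      (LinearMap.mk₂ k (fun v (f : D.carrier) => balancedTmul k S v (MulOpposite.op t • f))
        (fun v w f => add_balancedTmul _ _ _)
        (fun r v f => by
          simp only [balancedTmul, ← TensorProduct.smul_tmul', map_smul])
        (fun v f g => by rw [smul_add, balancedTmul_add])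
        (fun r v f => by
          rw [smul_comm]
          simp only [balancedTmul, TensorProduct.tmul_smul, map_smul]))
      (fun v s f => by
        change balancedTmul k S _ (MulOpposite.op t • f) =
          balancedTmul k S v (MulOpposite.op t • s • f)
        rw [← smul_comm, balancedTmul_smul])
  have hR : ∀ t v f, R t (balancedTmul k S v f) = balancedTmul k S v (MulOpposite.op t • f) :=
    fun t v f => balancedLift_tmul _ _ v f
  have hRadd : ∀ s t x, R (s + t) x = R s x + R t x := by
    intro s t x
    induction x using balancedTensor_induction with
    | zero => simp
    | tmul v f => rw [hR, hR, hR, MulOpposite.op_add, add_smul, balancedTmul_add]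
    | add x y hx hy => rw [map_add, map_add, map_add, hx, hy]; abel
  have hR0 : ∀ x, R 0 x = 0 := fun x => by simpa using hRadd 0 0 x
  have hR1 : ∀ x, R 1 x = x := by
    intro x
    induction x using balancedTensor_induction with
    | zero => simp
    | tmul v f => rw [hR, MulOpposite.op_one, one_smul]
    | add x y hx hy => rw [map_add, hx, hy]
  have key : ∀ (f : D.carrier) v x, R (toMap f v) x = balancedTmul k S (ev x • v) f := by
    intro f v x
    induction x using balancedTensor_induction with
    | zero => rw [map_zero, map_zero, zero_smul, zero_balancedTmul]
    | tmul w g =>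
      obtain ⟨s, hs⟩ := h.exists_endo_eq ((toMap g).smulRight v)
      have hgf : MulOpposite.op (toMap f v) • g = s • f := by
        refine LinearMap.ext (R := S) fun u => ?_
        change toMap g u * toMap f v = toMap f (MulOpposite.op s • u)
        rw [← hs, LinearMap.smulRight_apply, map_smul, smul_eq_mul]
      rw [hR, hgf, balancedTmul_smul, ← hs, hev, LinearMap.smulRight_apply]
    | add x y hx hy => rw [map_add, map_add, hx, hy, add_smul, add_balancedTmul]
  have hbij : Function.Bijective ev := by
    refine ⟨(injective_iff_map_eq_zero _).2 fun x hx => ?_, fun s => ?_⟩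
    on_goal 2 =>
      refine h.induction (C := fun s => ∃ x, ev x = s) ⟨0, map_zero _⟩ (fun f v => ⟨_, hev v f⟩) ?_ s
      rintro _ _ ⟨x, rfl⟩ ⟨y, rfl⟩
      exact ⟨x + y, map_add _ _ _⟩
    rw [← hR1 x]
    refine h.induction (C := fun s => R s x = 0) (hR0 x) (fun f v => ?_)
      (fun s t hs ht => by rw [hRadd, hs, ht, add_zero]) 1
    refine (key f v x).trans ?_
    rw [hx, zero_smul]
    exact zero_balancedTmul (W := D.carrier) f
  let E : BalancedTensor k S V D.carrier ≃+ S := AddEquiv.ofBijective ev hbij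
  have hE : ∀ x, E x = ev x := fun _ => rfl
  refine ⟨E, fun s t v f => ?_⟩
  refine ((hE _).trans (hev _ _)).trans ?_
  refine Eq.trans ?_ (congrArg (fun r => s * r * t) ((hE _).trans (hev v f))).symm
  change toMap f (s • v) * t = s * toMap f v * t
  rw [map_smul, smul_eq_mul]

theorem exists_dual_basis (S V : Type u) [Ring S] [IsSemisimpleRing S] [AddCommGroup V] [Module S V]
    [Module.Finite S V] :
    ∃ (n : ℕ) (f : Fin n → V →ₗ[S] S) (v : Fin n → V), ∀ w, ∑ i, f i w • v i = w := by
  have := Module.projective_of_isSemisimpleRing S V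
  obtain ⟨n, p, q, -, -, hpq⟩ := Module.Finite.exists_comp_eq_id_of_projective S V
  refine ⟨n, fun i => LinearMap.proj i ∘ₗ q, fun i => p fun j => if i = j then 1 else 0, fun w => ?_⟩
  have h := LinearMap.congr_fun hpq w
  rw [LinearMap.comp_apply, LinearMap.pi_apply_eq_sum_univ p] at h
  exact h

/-- The action `Hom_S(V, S) ⊗_S V → End_S(V) = S` is an isomorphism. -/
theorem IsMoritaBimodule.dual_balancedTensorIsoRing [IsSemisimpleRing S] [Module.Finite S V]
    (h : IsMoritaBimodule S V) :
    BalancedTensorIsoRing k S (dualBimodule k S V).carrier V := by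
  let D := dualBimodule k S V
  let toMap : D.carrier ≃ₗ[k] (V →ₗ[S] S) := LinearEquiv.refl k _
  let r : S ≃+ (V →ₗ[S] V) := AddEquiv.ofBijective
    (AddMonoidHom.mk' (rightMulEnd V) fun s t => LinearMap.ext fun v => by
      simp [rightMulEnd_apply, add_smul])
    ⟨(injective_iff_map_eq_zero _).2 fun s hs =>
      h.faithful s fun v => LinearMap.congr_fun hs v, fun φ => by
      obtain ⟨s, hs⟩ := h.exists_endo_eq φ
      exact ⟨s, LinearMap.ext fun v => (hs v).symm⟩⟩
  have hr : ∀ s v, r s v = MulOpposite.op s • v := fun s v => rfl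
  let Φ : BalancedTensor k S D.carrier V →ₗ[k] (V →ₗ[S] V) := balancedLift
    (LinearMap.mk₂ k (fun (f : D.carrier) v => (toMap f).smulRight v)
      (fun f g v => by ext w; exact add_smul (toMap f w) (toMap g w) v)
      (fun c f v => by ext w; exact smul_assoc c (toMap f w) v)
      (fun f v v' => by ext w; exact smul_add (toMap f w) v v')
      (fun c f v => by ext w; exact smul_comm (toMap f w) c v))
    (fun f s v => by ext w; exact mul_smul (toMap f w) s v)
  have hΦ : ∀ f v, Φ (balancedTmul k S f v) = (toMap f).smulRight v :=
    fun f v => balancedLift_tmul _ _ f v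
  obtain ⟨n, b, u, hbu⟩ := exists_dual_basis S V
  have key : ∀ x, x = ∑ i, balancedTmul k S (toMap.symm (b i)) (Φ x (u i)) := by
    intro x
    induction x using balancedTensor_induction with
    | zero => simp [balancedTmul]
    | tmul f v =>
      have hf : f = ∑ i, MulOpposite.op (toMap f (u i)) • toMap.symm (b i) := by
        apply toMap.injective
        ext w
        rw [map_sum, LinearMap.sum_apply]
        nth_rewrite 1 [← hbu w]
        rw [map_sum]
        refine Finset.sum_congr rfl fun i _ => ?_
        rw [map_smul]
        rfl
      nth_rewrite 1 [hf]
      rw [sum_balancedTmul]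
      refine Finset.sum_congr rfl fun i _ => ?_
      rw [hΦ, LinearMap.smulRight_apply, balancedTmul_smul]
    | add x y hx hy =>
      nth_rewrite 1 [hx, hy]
      rw [← Finset.sum_add_distrib]
      refine Finset.sum_congr rfl fun i _ => ?_
      rw [← balancedTmul_add, map_add, LinearMap.add_apply]
  have hbij : Function.Bijective Φ := by
    refine ⟨(injective_iff_map_eq_zero _).2 fun x hx => ?_, fun φ => ?_⟩
    · rw [key x, hx]
      simp [balancedTmul]
    · refine ⟨∑ i, balancedTmul k S (toMap.symm (b i)) (φ (u i)), LinearMap.ext fun w => ?_⟩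
      rw [map_sum, LinearMap.sum_apply]
      simp only [hΦ, LinearMap.smulRight_apply, LinearEquiv.apply_symm_apply, ← map_smul]
      rw [← map_sum, hbu]
  let E : BalancedTensor k S D.carrier V ≃+ (V →ₗ[S] V) := AddEquiv.ofBijective Φ hbij
  have hE : ∀ x, E x = Φ x := fun _ => rfl
  refine ⟨E.trans r.symm, fun s t f v => ?_⟩
  obtain ⟨z, hz⟩ : ∃ z, r z = Φ (balancedTmul k S f v) := r.surjective _
  have hz' : r.symm (E (balancedTmul k S f v)) = z := by
    rw [AddEquiv.symm_apply_eq]; exact hz.symm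
  rw [AddEquiv.trans_apply, AddEquiv.trans_apply, AddEquiv.symm_apply_eq, hz', hE]
  refine (hΦ _ _).trans ?_
  ext w
  rw [hΦ] at hz
  have hw := LinearMap.congr_fun hz (MulOpposite.op s • w)
  rw [hr, LinearMap.smulRight_apply] at hw
  rw [hr, MulOpposite.op_mul, MulOpposite.op_mul, mul_smul, mul_smul, hw, LinearMap.smulRight_apply]
  exact smul_comm _ _ _

end Dual

end Invertible

/-! ### Computing `Ext_A(A / J, A)` from `0 → J → A → A / J → 0` -/

section Ext

open Abelian

variable {k A : Type u} [Field k] [Ring A] [Algebra k A] (𝒜 : ℕ → Submodule k A)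
  [GradedAlgebra 𝒜]

/-- The short complex `J → A → A / J` of left `A`-modules, where `J` is the graded Jacobson
radical. -/
noncomputable abbrev radicalComplex : ShortComplex (ModuleCat.{u} A) where
  X₁ := ModuleCat.of A (gradedJacobson 𝒜)
  X₂ := ModuleCat.of A A
  X₃ := ModuleCat.of A (SemisimpleQuotient 𝒜)
  f := ModuleCat.ofHom (gradedJacobson 𝒜).subtype
  g := ModuleCat.ofHom (gradedJacobson 𝒜).mkQ
  zero := by
    ext x
    exact (Submodule.Quotient.mk_eq_zero _).2 x.2

theorem radicalComplex_shortExact : (radicalComplex 𝒜).ShortExact where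
  exact := by
    rw [ShortComplex.moduleCat_exact_iff]
    intro x hx
    exact ⟨⟨x, (Submodule.Quotient.mk_eq_zero _).1 hx⟩, rfl⟩
  mono_f := (ModuleCat.mono_iff_injective _).2 Subtype.val_injective
  epi_g := (ModuleCat.epi_iff_surjective _).2 (Submodule.mkQ_surjective _)

/-- The connecting homomorphism `Hom_A(J, A) → Ext¹_A(A / J, A)`. -/
noncomputable def radicalConnecting : (gradedJacobson 𝒜 →ₗ[A] A) →+ ExtSA 𝒜 1 where
  toFun x := (radicalComplex_shortExact 𝒜).extClass.comp (Ext.mk₀ (ModuleCat.ofHom x)) (add_zero 1)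
  map_zero' := by
    have : (ModuleCat.ofHom (0 : gradedJacobson 𝒜 →ₗ[A] A)) = 0 := rfl
    rw [this, Ext.mk₀_zero, Ext.comp_zero]
  map_add' x y := by
    have : ModuleCat.ofHom (x + y) = ModuleCat.ofHom x + ModuleCat.ofHom y := rfl
    rw [this, Ext.mk₀_add, Ext.comp_add]

theorem radicalConnecting_surjective : Function.Surjective (radicalConnecting 𝒜) := by
  intro x
  have : Projective (ModuleCat.of A A) := (IsProjective.iff_projective A).1 inferInstance
  obtain ⟨y, hy⟩ := Ext.contravariant_sequence_exact₃ (radicalComplex_shortExact 𝒜) _ x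
    (Ext.eq_zero_of_projective _) (add_zero 1)
  refine ⟨(Ext.addEquiv₀ y).hom, ?_⟩
  rw [← hy]
  change Ext.comp _ (Ext.mk₀ (Ext.addEquiv₀ y)) (add_zero 1) = _
  rw [Ext.mk₀_addEquiv₀_apply]

theorem radicalConnecting_eq_zero_iff (x : gradedJacobson 𝒜 →ₗ[A] A) :
    radicalConnecting 𝒜 x = 0 ↔ ∃ a : A, ∀ j : gradedJacobson 𝒜, x j = j * a := by
  constructor
  · intro h
    obtain ⟨y, hy⟩ := Ext.contravariant_sequence_exact₁ (radicalComplex_shortExact 𝒜) _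
      (Ext.mk₀ (ModuleCat.ofHom x)) (add_zero 1) h
    obtain ⟨y, rfl⟩ := Ext.addEquiv₀.symm.surjective y
    have hy : (radicalComplex 𝒜).f ≫ y = ModuleCat.ofHom x := by
      apply Ext.addEquiv₀.symm.injective
      refine Eq.trans ?_ hy
      exact (Ext.mk₀_comp_mk₀ _ _).symm
    refine ⟨y.hom (1 : A), fun j => ?_⟩
    have h1 : x j = y.hom (j : A) := (LinearMap.congr_fun (congrArg ModuleCat.Hom.hom hy) j).symm
    rw [h1, ← smul_eq_mul, ← map_smul, smul_eq_mul, mul_one]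
  · rintro ⟨a, ha⟩
    have h : ModuleCat.ofHom x =
        (radicalComplex 𝒜).f ≫ ModuleCat.ofHom (LinearMap.toSpanSingleton A A a) := by
      ext j
      exact ha j
    change Ext.comp _ (Ext.mk₀ (ModuleCat.ofHom x)) (add_zero 1) = 0
    rw [h, ← Ext.mk₀_comp_mk₀]
    exact ShortComplex.ShortExact.extClass_comp_assoc _ _

theorem radicalConnecting_rightAct (x : gradedJacobson 𝒜 →ₗ[A] A) (a : A) :
    radicalConnecting 𝒜 (LinearMap.toSpanSingleton A A a ∘ₗ x) =
      ExtSA.rightAct 𝒜 (radicalConnecting 𝒜 x) a := by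
  change Ext.comp _ (Ext.mk₀ (ModuleCat.ofHom x ≫
      ModuleCat.ofHom (LinearMap.toSpanSingleton A A a))) (add_zero 1) =
    (Ext.comp _ (Ext.mk₀ (ModuleCat.ofHom x)) (add_zero 1)).comp _ (add_zero 1)
  rw [← Ext.mk₀_comp_mk₀, Ext.comp_assoc_of_third_deg_zero]

/-- Right multiplication by `a` on the two-sided ideal `J`. -/
def radicalMulRight (a : A) : gradedJacobson 𝒜 →ₗ[A] gradedJacobson 𝒜 where
  toFun j := ⟨j * a, gradedJacobson_mul_mem 𝒜 j.2⟩
  map_add' _ _ := Subtype.ext (add_mul _ _ _)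
  map_smul' b j := Subtype.ext (mul_assoc b (j : A) a)

theorem radicalConnecting_leftAct (x : gradedJacobson 𝒜 →ₗ[A] A) (a : A) :
    radicalConnecting 𝒜 (x ∘ₗ radicalMulRight 𝒜 a) =
      ExtSA.leftAct 𝒜 (Ideal.Quotient.mk _ a) (radicalConnecting 𝒜 x) := by
  let φ : radicalComplex 𝒜 ⟶ radicalComplex 𝒜 :=
    { τ₁ := ModuleCat.ofHom (radicalMulRight 𝒜 a)
      τ₂ := ModuleCat.ofHom (LinearMap.toSpanSingleton A A a)
      τ₃ := ModuleCat.ofHom (quotMulRight 𝒜 (Ideal.Quotient.mk _ a))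
      comm₁₂ := rfl
      comm₂₃ := rfl }
  have h := ShortComplex.ShortExact.extClass_naturality (radicalComplex_shortExact 𝒜)
    (radicalComplex_shortExact 𝒜) φ
  change Ext.comp _ (Ext.mk₀ (φ.τ₁ ≫ ModuleCat.ofHom x)) (add_zero 1) =
    (Ext.mk₀ φ.τ₃).comp (Ext.comp _ (Ext.mk₀ (ModuleCat.ofHom x)) (add_zero 1)) (zero_add 1)
  rw [← Ext.mk₀_comp_mk₀, ← Ext.comp_assoc_of_second_deg_zero, h]
  exact Ext.comp_assoc_of_third_deg_zero _ _ _ _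

theorem subsingleton_extSA_of_projective [Module.Projective A (gradedJacobson 𝒜)] (i : ℕ) :
    Subsingleton (ExtSA 𝒜 (i + 2)) := by
  have : Projective (ModuleCat.of A A) := (IsProjective.iff_projective A).1 inferInstance
  have : Projective (ModuleCat.of A (gradedJacobson 𝒜)) :=
    (IsProjective.iff_projective _).1 inferInstance
  refine subsingleton_of_forall_eq 0 fun x => ?_
  obtain ⟨y, hy⟩ := Ext.contravariant_sequence_exact₃ (radicalComplex_shortExact 𝒜) _ x
    (Ext.eq_zero_of_projective _) (show 1 + (i + 1) = i + 2 by omega)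
  rw [← hy, Ext.eq_zero_of_projective y, Ext.comp_zero]

theorem subsingleton_extSA_zero_iff : Subsingleton (ExtSA 𝒜 0) ↔
    ∀ a : A, (∀ j ∈ gradedJacobson 𝒜, j * a = 0) → a = 0 := by
  rw [Ext.addEquiv₀.toEquiv.subsingleton_congr]
  constructor
  · intro h a ha
    let f : SemisimpleQuotient 𝒜 →ₗ[A] A :=
      (gradedJacobson 𝒜).liftQ (LinearMap.toSpanSingleton A A a) ha
    have h1 : ModuleCat.ofHom f = 0 := Subsingleton.elim _ _
    have h2 : f (Ideal.Quotient.mk _ 1) = 0 :=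
      LinearMap.congr_fun (congrArg ModuleCat.Hom.hom h1) _
    have h3 : f (Ideal.Quotient.mk _ 1) = 1 * a := rfl
    rwa [h3, one_mul] at h2
  · intro h
    refine subsingleton_of_forall_eq 0 fun f => ?_
    have h1 : f.hom (Ideal.Quotient.mk _ 1) = 0 := by
      refine h _ fun j hj => ?_
      rw [← smul_eq_mul, ← map_smul]
      have h2 : j • Ideal.Quotient.mk (gradedJacobson 𝒜) 1 = 0 := by
        refine (Submodule.Quotient.mk_eq_zero (gradedJacobson 𝒜)).2 ?_
        change j * 1 ∈ _
        rwa [mul_one]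
      rw [h2, map_zero]
    refine ModuleCat.hom_ext (LinearMap.ext fun b => ?_)
    obtain ⟨b, rfl⟩ := Ideal.Quotient.mk_surjective b
    have h3 : Ideal.Quotient.mk (gradedJacobson 𝒜) b =
        b • Ideal.Quotient.mk (gradedJacobson 𝒜) 1 :=
      congrArg (Ideal.Quotient.mk _) (mul_one b).symm
    rw [h3]
    refine (map_smul f.hom b _).trans ?_
    rw [h1, smul_zero]
    rfl

end Ext

namespace BimoduleTensorAlgebra

/-! ### `Ext¹` of the tensor algebra -/

section Ext

variable {k S V : Type u} [Field k] [Ring S] [Algebra k S]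
  [AddCommGroup V] [Module k V] [Module S V] [Module Sᵐᵒᵖ V]

variable (k S V) in
/-- The group `Hom_S(V, T_S(V))` of left `S`-linear maps. -/
def leftHom : AddSubgroup (V →+ BimoduleTensorAlgebra k S V) where
  carrier := {h | ∀ s v, h (s • v) = ofRing k S V s * h v}
  zero_mem' s v := by simp
  add_mem' hg hh s v := by simp [hg s v, hh s v, mul_add]
  neg_mem' hh s v := by simp [hh s v]

namespace leftHom

/-- The left `S`-linear map `v ↦ f(v) ∈ S` given by a linear form `f`. -/
noncomputable def ofForm (f : V →ₗ[S] S) : leftHom k S V :=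
  ⟨(ofRing k S V : S →+ BimoduleTensorAlgebra k S V).comp f.toAddMonoidHom, fun s v => by simp⟩

theorem ofForm_apply (f : V →ₗ[S] S) (v : V) :
    (ofForm f : leftHom k S V).1 v = ofRing k S V (f v) := rfl

/-- The left `S`-linear map `v ↦ h(v) a`. -/
noncomputable def mulRight (h : leftHom k S V) (a : BimoduleTensorAlgebra k S V) : leftHom k S V :=
  ⟨(AddMonoidHom.mulRight a).comp h.1, fun s v => by simp [h.2 s v, mul_assoc]⟩

theorem mulRight_apply (h : leftHom k S V) (a : BimoduleTensorAlgebra k S V) (v : V) :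
    (mulRight h a).1 v = h.1 v * a := rfl

/-- The linear form `v ↦ ε(h(v))`, where `ε` is the augmentation. -/
noncomputable def toForm (h : leftHom k S V) : V →ₗ[S] S where
  toFun v := augmentation k S V (h.1 v)
  map_add' v w := by simp
  map_smul' s v := by rw [h.2 s v, map_mul, augmentation_ofRing]; rfl

theorem sub_ofForm_toForm_mem (h : leftHom k S V) (v : V) :
    (h - ofForm (toForm h)).1 v ∈ augIdeal k S V :=
  sub_ofRing_augmentation_mem (h.1 v)

theorem eq_sum_mulRight (h : leftHom k S V) {n : ℕ} {f : Fin n → V →ₗ[S] S} {v : Fin n → V}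
    (hfv : ∀ w, ∑ i, f i w • v i = w) : h = ∑ i, mulRight (ofForm (f i)) (h.1 (v i)) := by
  apply Subtype.ext
  ext w
  rw [AddSubgroup.val_finsetSum, AddMonoidHom.finsetSum_apply]
  nth_rewrite 1 [← hfv w]
  rw [map_sum]
  exact Finset.sum_congr rfl fun i _ => h.2 _ _

end leftHom

variable [SMulCommClass S Sᵐᵒᵖ V] [IsScalarTower k S V] [IsScalarTower k Sᵐᵒᵖ V]
  (𝒱 : ℕ → Submodule k V) [DirectSum.Decomposition 𝒱] [IsGradedBimodule (S := S) 𝒱]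
  [IsSemisimpleRing S] [Module.Finite k (grading S 𝒱 0)]

theorem projective_gradedJacobson :
    Module.Projective (BimoduleTensorAlgebra k S V) (gradedJacobson (grading S 𝒱)) := by
  rw [gradedJacobson_eq_augIdeal]
  refine Module.Projective.of_lifting_property'' fun g hg => ?_
  let : Module S (augIdeal k S V) := Module.compHom _ (ofRing k S V).toRingHom
  let : Module S (augIdeal k S V →₀ BimoduleTensorAlgebra k S V) :=
    Module.compHom _ (ofRing k S V).toRingHom
  let g' : (augIdeal k S V →₀ BimoduleTensorAlgebra k S V) →ₗ[S] augIdeal k S V :=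
    { g with map_smul' := fun s x => map_smul g (ofRing k S V s) x }
  let i : V →ₗ[S] augIdeal k S V :=
    { toFun := fun v => ⟨ofBimodule k S V v, ofBimodule_mem_augIdeal v⟩
      map_add' := fun v w => Subtype.ext (map_add _ v w)
      map_smul' := fun s v => Subtype.ext (ofBimodule_smul k S V s v) }
  have := Module.projective_of_isSemisimpleRing S V
  obtain ⟨σ, hσ⟩ := Module.projective_lifting_property g' i hg
  obtain ⟨D, hD⟩ := exists_extend_augIdeal (k := k) (S := S) σ.toAddMonoidHom
    (fun s v => map_smul σ s v)
  refine ⟨D, augIdeal_linearMap_ext fun v => ?_⟩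
  rw [LinearMap.comp_apply, hD]
  exact LinearMap.congr_fun hσ v

/-- Restriction to `V` is an isomorphism from `Hom_A(J, A)` to `Hom_S(V, A)`. -/
theorem exists_leftHom_equiv :
    ∃ D : leftHom k S V ≃+ (gradedJacobson (grading S 𝒱) →ₗ[BimoduleTensorAlgebra k S V]
        BimoduleTensorAlgebra k S V),
      ∀ h v, D h ⟨ofBimodule k S V v, ofBimodule_mem_gradedJacobson 𝒱 v⟩ = h.1 v := by
  have hJ := gradedJacobson_eq_augIdeal (S := S) 𝒱
  let r : (gradedJacobson (grading S 𝒱) →ₗ[BimoduleTensorAlgebra k S V]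
      BimoduleTensorAlgebra k S V) →+ leftHom k S V := AddMonoidHom.mk'
    (fun E => ⟨AddMonoidHom.mk' (fun v => E ⟨_, ofBimodule_mem_gradedJacobson 𝒱 v⟩) fun v w => by
        rw [← map_add]; congr 1; exact Subtype.ext (map_add _ v w), fun s v => by
        change E _ = ofRing k S V s * E _
        rw [← smul_eq_mul, ← map_smul]; congr 1; exact Subtype.ext (ofBimodule_smul k S V s v)⟩)
    fun E F => rfl
  have hr : Function.Bijective r := by
    constructor
    · intro D E h
      have h1 : D ∘ₗ Submodule.inclusion hJ.ge = E ∘ₗ Submodule.inclusion hJ.ge :=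
        augIdeal_linearMap_ext fun v => DFunLike.congr_fun (congrArg Subtype.val h) v
      ext x
      exact LinearMap.congr_fun h1 ⟨x, hJ ▸ x.2⟩
    · intro h
      obtain ⟨D, hD⟩ := exists_extend_augIdeal (k := k) (S := S) h.1 (fun s v => h.2 s v)
      exact ⟨D ∘ₗ Submodule.inclusion hJ.le, Subtype.ext (AddMonoidHom.ext hD)⟩
  refine ⟨(AddEquiv.ofBijective r hr).symm, fun h v => ?_⟩
  obtain ⟨E, rfl⟩ := hr.2 h
  have h1 : (AddEquiv.ofBijective r hr).symm (r E) = E :=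
    (AddEquiv.ofBijective r hr).symm_apply_apply E
  rw [h1]
  rfl

theorem leftHom_equiv_ext {D E : gradedJacobson (grading S 𝒱) →ₗ[BimoduleTensorAlgebra k S V]
      BimoduleTensorAlgebra k S V}
    (h : ∀ v, D ⟨ofBimodule k S V v, ofBimodule_mem_gradedJacobson 𝒱 v⟩ =
      E ⟨ofBimodule k S V v, ofBimodule_mem_gradedJacobson 𝒱 v⟩) : D = E := by
  obtain ⟨Φ, hΦ⟩ := exists_leftHom_equiv (k := k) (S := S) 𝒱
  apply Φ.symm.injective
  apply Subtype.ext
  ext v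
  rw [← hΦ, ← hΦ, Φ.apply_symm_apply, Φ.apply_symm_apply, h]

variable (S) in
/-- As `J` is generated by `V` over `S`, the group `Ext¹_A(S, A)` is the cokernel of the map
`A → Hom_S(V, A)` which sends `a` to `v ↦ v a`. -/
theorem exists_extConnecting :
    ∃ Θ : leftHom k S V →+ ExtSA (grading S 𝒱) 1, Function.Surjective Θ ∧
      (∀ h, Θ h = 0 ↔ ∃ a, ∀ v, h.1 v = ofBimodule k S V v * a) ∧
      (∀ h a, Θ (leftHom.mulRight h a) = ExtSA.rightAct (grading S 𝒱) (Θ h) a) ∧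
      (∀ h h' s, (∀ v, h'.1 v = h.1 (MulOpposite.op s • v)) →
        Θ h' = ExtSA.leftAct (grading S 𝒱) (Ideal.Quotient.mk _ (ofRing k S V s)) (Θ h)) := by
  obtain ⟨D, hD⟩ := exists_leftHom_equiv (k := k) (S := S) 𝒱
  refine ⟨(radicalConnecting (grading S 𝒱)).comp D.toAddMonoidHom,
    (radicalConnecting_surjective _).comp D.surjective, fun h => ?_, fun h a => ?_,
    fun h h' s hs => ?_⟩
  · refine (radicalConnecting_eq_zero_iff _ _).trans ⟨?_, ?_⟩
    · rintro ⟨a, ha⟩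
      exact ⟨a, fun v => (hD h v).symm.trans (ha _)⟩
    · rintro ⟨a, ha⟩
      have h1 : D h = LinearMap.toSpanSingleton _ _ a ∘ₗ (gradedJacobson (grading S 𝒱)).subtype :=
        leftHom_equiv_ext 𝒱 fun v => (hD h v).trans (ha v)
      exact ⟨a, fun x => LinearMap.congr_fun h1 x⟩
  · refine Eq.trans (congrArg (radicalConnecting (grading S 𝒱)) ?_)
      (radicalConnecting_rightAct (grading S 𝒱) (D h) a)
    refine leftHom_equiv_ext 𝒱 fun v => ?_
    rw [LinearMap.comp_apply, hD]
    exact hD _ v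
  · refine Eq.trans (congrArg (radicalConnecting (grading S 𝒱)) ?_)
      (radicalConnecting_leftAct (grading S 𝒱) (D h) (ofRing k S V s))
    refine leftHom_equiv_ext 𝒱 fun v => ?_
    refine (hD h' v).trans ?_
    rw [LinearMap.comp_apply, hs, ← hD]
    congr 1
    exact Subtype.ext (ofBimodule_op_smul k S V s v)

end Ext

end BimoduleTensorAlgebra

namespace BimoduleTensorAlgebra

/-! ### Invertibility from regularity -/

section Main

variable {k S V : Type u} [Field k] [Ring S] [Algebra k S]
  [AddCommGroup V] [Module k V] [Module S V] [Module Sᵐᵒᵖ V]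

/-- If every endomorphism of `V` is a right multiplication, then every left `S`-linear map from `V`
to the augmentation ideal `J = V · A` is given by right multiplication by an element of `A`. -/
theorem exists_eq_ofBimodule_mul [IsSemisimpleRing S] [Module.Finite S V]
    (hV : ∀ φ : V →ₗ[S] V, ∃ s : S, ∀ v, φ v = MulOpposite.op s • v) (h : leftHom k S V)
    (hJ : ∀ v, h.1 v ∈ augIdeal k S V) : ∃ a, ∀ v, h.1 v = ofBimodule k S V v * a := by
  have key : ∀ (f : V →ₗ[S] S), ∀ x ∈ augIdeal k S V,
      ∃ a, ∀ v, ofRing k S V (f v) * x = ofBimodule k S V v * a := by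
    intro f x hx
    replace hx := mem_span_op_of_mem_augIdeal hx
    induction hx using Submodule.span_induction with
    | mem x hx =>
      obtain ⟨w, rfl⟩ := hx
      obtain ⟨s, hs⟩ := hV (f.smulRight w)
      refine ⟨ofRing k S V s, fun v => ?_⟩
      rw [← ofBimodule_smul, ← ofBimodule_op_smul, ← hs, LinearMap.smulRight_apply]
    | zero => exact ⟨0, by simp⟩
    | add x y _ _ hx hy =>
      obtain ⟨a, ha⟩ := hx
      obtain ⟨b, hb⟩ := hy
      exact ⟨a + b, fun v => by rw [mul_add, ha, hb, mul_add]⟩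
    | smul b x _ hx =>
      obtain ⟨a, ha⟩ := hx
      exact ⟨MulOpposite.op b.unop • a, fun v => by
        rw [mul_smul_comm, MulOpposite.op_unop, ha, mul_smul_comm]⟩
  obtain ⟨n, f, u, hfu⟩ := exists_dual_basis S V
  choose a ha using fun i => key (f i) (h.1 (u i)) (hJ _)
  refine ⟨∑ i, a i, fun v => ?_⟩
  nth_rewrite 1 [← hfu v]
  rw [map_sum, Finset.mul_sum]
  exact Finset.sum_congr rfl fun i _ => (h.2 _ _).trans (ha i v)

section

variable (𝒱 : ℕ → Submodule k V) [DirectSum.Decomposition 𝒱] [IsGradedBimodule (S := S) 𝒱]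
  [IsSemisimpleRing S] [Module.Finite k (grading S 𝒱 0)]

variable (S) in
/-- The isomorphism of `S` with the quotient of `T_S(V)` by its graded Jacobson radical. -/
theorem exists_quotient_equiv : ∃ ρ : S ≃ₐ[k] SemisimpleQuotient (grading S 𝒱),
    ∀ a : BimoduleTensorAlgebra k S V,
      Ideal.Quotient.mk (gradedJacobson (grading S 𝒱)) a = ρ (augmentation k S V a) := by
  have hJ := gradedJacobson_eq_augIdeal (S := S) 𝒱
  let ρ := (Ideal.Quotient.mkₐ k (gradedJacobson (grading S 𝒱))).comp (ofRing k S V)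
  have hρ : ∀ a : BimoduleTensorAlgebra k S V,
      Ideal.Quotient.mk (gradedJacobson (grading S 𝒱)) a = ρ (augmentation k S V a) := by
    intro a
    refine Ideal.Quotient.eq.2 ?_
    rw [hJ]
    exact sub_ofRing_augmentation_mem a
  have hbij : Function.Bijective ρ := by
    refine ⟨(injective_iff_map_eq_zero _).2 fun s hs => ?_, fun x => ?_⟩
    · have h1 := Ideal.Quotient.eq_zero_iff_mem.1 hs
      rw [hJ, RingHom.mem_ker] at h1
      exact (augmentation_ofRing s).symm.trans h1
    · obtain ⟨a, rfl⟩ := Ideal.Quotient.mk_surjective x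
      exact ⟨_, (hρ a).symm⟩
  exact ⟨AlgEquiv.ofBijective ρ hbij, hρ⟩

end

variable [SMulCommClass S Sᵐᵒᵖ V] [IsScalarTower k S V] [IsScalarTower k Sᵐᵒᵖ V]

/-- If `V` is invertible with inverse `W`, the pairing `W ⊗_S V ≅ S` shows that only `0` is killed
by left multiplication by `V`. -/
theorem eq_zero_of_forall_ofBimodule_mul_eq_zero (h : IsInvertibleBimodule k S V)
    {a : BimoduleTensorAlgebra k S V} (ha : ∀ v, ofBimodule k S V v * a = 0) : a = 0 := by
  obtain ⟨W, -, hWV⟩ := h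
  obtain ⟨b, -, -, -, hb2, -, hb⟩ := BalancedTensorIsoRing.exists_pairing hWV
  have key : ∀ s : S, ofRing k S V s * a = 0 := by
    refine hb (fun s => ofRing k S V s * a = 0) (by simp) (fun w v => ?_)
      (fun x y hx hy => by rw [map_add, add_mul, hx, hy, add_zero])
    exact apply_mul_eq_zero_of_ofBimodule_mul_eq_zero
      ((ofRing k S V).toLinearMap ∘ₗ b w) (fun s v => by simp [hb2]) (ha v)
  simpa using key 1

variable (𝒱 : ℕ → Submodule k V) [DirectSum.Decomposition 𝒱] [IsGradedBimodule (S := S) 𝒱]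
  [IsSemisimpleRing S] [Module.Finite k (grading S 𝒱 0)]

/-- If `A` is regular of dimension `1`, then `V` satisfies the Morita criterion. Faithfulness is
`Hom_A(S, A) = 0`. As `J` kills `Ext¹_A(S, A)`, which is the cokernel of `A → Hom_S(V, A)`, every
`S`-linear map `V → J` is of the form `v ↦ v a`; for maps with values in `V` this says that
endomorphisms are right multiplications. Therefore `Hom_S(V, S)` maps onto `Ext¹_A(S, A)`, on which
`S` acts faithfully from the right; but an element `c` of a complement of the trace ideal `T` of `V`
satisfies `T c = 0`, so that it kills `Hom_S(V, S)`. -/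
theorem isMoritaBimodule_of_isGeneralizedASRegular [Module.Finite S V]
    (h : IsGeneralizedASRegular (grading S 𝒱) 1) : IsMoritaBimodule S V := by
  obtain ⟨-, hext, U, hU, e, -, he⟩ := h
  have hJ := gradedJacobson_eq_augIdeal (S := S) 𝒱
  obtain ⟨ρ, hρ⟩ := exists_quotient_equiv S 𝒱
  obtain ⟨Θ, hΘs, hΘ0, hΘr, -⟩ := exists_extConnecting S 𝒱
  have h0 := (subsingleton_extSA_zero_iff _).1 (hext 0 zero_ne_one)
  have hzero : ∀ a : BimoduleTensorAlgebra k S V, (∀ v, ofBimodule k S V v * a = 0) → a = 0 := by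
    intro a ha
    refine h0 a fun x hx => ?_
    rw [hJ, augIdeal_eq_span] at hx
    induction hx using Submodule.span_induction with
    | mem x hx => obtain ⟨v, rfl⟩ := hx; exact ha v
    | zero => exact zero_mul a
    | add x y _ _ hx hy => rw [add_mul, hx, hy, add_zero]
    | smul b x _ hx => rw [smul_eq_mul, mul_assoc, hx, mul_zero]
  have hkill : ∀ (x : ExtSA (grading S 𝒱) 1), ∀ a ∈ augIdeal k S V,
      ExtSA.rightAct (grading S 𝒱) x a = 0 := by
    intro x a ha
    apply e.injective
    rw [he, map_zero, hρ, RingHom.mem_ker.1 ha, map_zero, MulOpposite.op_zero, zero_smul]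
  obtain ⟨n, f, u, hfu⟩ := exists_dual_basis S V
  have hΘJ : ∀ h : leftHom k S V, (∀ v, h.1 v ∈ augIdeal k S V) → Θ h = 0 := by
    intro h hh
    rw [leftHom.eq_sum_mulRight h hfu, map_sum]
    refine Finset.sum_eq_zero fun i _ => ?_
    rw [hΘr]
    exact hkill _ _ (hh _)
  refine ⟨fun s hs => ?_, fun φ => ?_, ?_⟩
  · have h1 : ofRing k S V s = 0 := hzero _ fun v => by
      rw [← ofBimodule_op_smul, hs, map_zero]
    rw [← augmentation_ofRing (k := k) (V := V) s, h1, map_zero]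
  · let h : leftHom k S V := ⟨(ofBimodule k S V : V →+ _).comp φ.toAddMonoidHom, fun s v => by
      change ofBimodule k S V (φ (s • v)) = _
      rw [map_smul, ofBimodule_smul]; rfl⟩
    obtain ⟨a, ha⟩ := (hΘ0 h).1 (hΘJ h fun v => ofBimodule_mem_augIdeal _)
    obtain ⟨q, hq, hqs⟩ := exists_augIdeal_projection k S V
    -- only the component of `a` in `S` contributes to the part of `v a` of length one
    refine ⟨augmentation k S V a, fun v => ?_⟩
    let a' : augIdeal k S V := ⟨_, sub_ofRing_augmentation_mem a⟩
    have h1 : (⟨ofBimodule k S V (φ v), ofBimodule_mem_augIdeal _⟩ : augIdeal k S V) =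
        ofBimodule k S V v • a' + ⟨ofBimodule k S V (MulOpposite.op (augmentation k S V a) • v),
          ofBimodule_mem_augIdeal _⟩ := by
      apply Subtype.ext
      change ofBimodule k S V (φ v) = ofBimodule k S V v * (a - _) +
        ofBimodule k S V (MulOpposite.op (augmentation k S V a) • v)
      rw [ofBimodule_op_smul, mul_sub, sub_add_cancel]
      exact ha v
    have h2 := congrArg q h1
    rwa [map_add, hq, hq, hqs, augmentation_ofBimodule, zero_smul, zero_add] at h2
  · set T : Submodule S S := Submodule.span S {s : S | ∃ (f : V →ₗ[S] S) (v : V), f v = s} with hT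
    have hTr : ∀ x ∈ T, ∀ t, x * t ∈ T := by
      intro x hx t
      induction hx using Submodule.span_induction with
      | mem x hx =>
        obtain ⟨f, v, rfl⟩ := hx
        exact Submodule.subset_span ⟨(LinearMap.toSpanSingleton S S t) ∘ₗ f, v, rfl⟩
      | zero => rw [zero_mul]; exact zero_mem _
      | add x y _ _ hx hy => rw [add_mul]; exact add_mem hx hy
      | smul a x _ hx => rw [smul_mul_assoc]; exact T.smul_mem _ hx
    have hTc : ∀ c : S, (∀ x ∈ T, x * c = 0) → c = 0 := by
      intro c hc
      have h1 : ∀ x : ExtSA (grading S 𝒱) 1, ExtSA.rightAct (grading S 𝒱) x (ofRing k S V c) = 0 := by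
        intro x
        obtain ⟨h, rfl⟩ := hΘs x
        have h2 : Θ h = Θ (leftHom.ofForm (leftHom.toForm h)) := by
          rw [← sub_eq_zero, ← map_sub]
          exact hΘJ _ (leftHom.sub_ofForm_toForm_mem h)
        have h3 : leftHom.mulRight (leftHom.ofForm (leftHom.toForm h)) (ofRing k S V c) =
            (0 : leftHom k S V) := by
          apply Subtype.ext
          ext v
          rw [leftHom.mulRight_apply, leftHom.ofForm_apply, ← map_mul,
            hc _ (Submodule.subset_span ⟨_, v, rfl⟩), map_zero]
          rfl
        rw [h2, ← hΘr, h3, map_zero]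
      have h2 : ρ c = 0 := by
        refine hU.isMoritaBimodule.faithful _ fun y => ?_
        obtain ⟨x, rfl⟩ := e.surjective y
        have h3 := he x (ofRing k S V c)
        rwa [h1, map_zero, hρ, augmentation_ofRing, eq_comm] at h3
      exact (map_eq_zero_iff ρ ρ.injective).1 h2
    obtain ⟨C, hC⟩ := exists_isCompl T
    obtain ⟨t, ht, c, hc, htc⟩ := Submodule.mem_sup.1
      (hC.sup_eq_top ▸ Submodule.mem_top : (1 : S) ∈ T ⊔ C)
    have hc0 : c = 0 := hTc c fun x hx => by
      have h1 : x * c ∈ T ⊓ C := ⟨hTr x hx c, C.smul_mem x hc⟩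
      rwa [hC.inf_eq_bot, Submodule.mem_bot] at h1
    rw [Ideal.eq_top_iff_one, ← htc, hc0, add_zero]
    exact ht

end Main

end BimoduleTensorAlgebra

/-! ### Restriction along an isomorphism of rings -/

section Restrict

variable {k S S' : Type u} [Field k] [Ring S] [Algebra k S] [Ring S'] [Algebra k S']

/-- The `(S', S')`-bimodule obtained from an `(S, S)`-bimodule by restriction of both actions along
an isomorphism `S' ≃ S`. -/
def CentralBimodule.restrict (ρ : S' ≃ₐ[k] S) (U : CentralBimodule k S) : CentralBimodule k S' :=
  letI : Module S' U.carrier := Module.compHom _ (ρ : S' →+* S)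
  letI : Module S'ᵐᵒᵖ U.carrier := Module.compHom _ (RingHom.op (ρ : S' →+* S))
  { carrier := U.carrier
    comm := ⟨fun s t u => smul_comm (ρ s) (MulOpposite.op (ρ t.unop)) u⟩
    towl := ⟨fun c s u => by
      change ρ (c • s) • u = c • ρ s • u
      rw [map_smul, smul_assoc]⟩
    towr := ⟨fun c s u => by
      change MulOpposite.op (ρ (c • s.unop)) • u = c • MulOpposite.op (ρ s.unop) • u
      rw [map_smul, MulOpposite.op_smul, smul_assoc]⟩ }

theorem BalancedTensorIsoRing.restrict (ρ : S' ≃ₐ[k] S) {U W : CentralBimodule k S}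
    (h : BalancedTensorIsoRing k S U.carrier W.carrier) :
    BalancedTensorIsoRing k S' (U.restrict ρ).carrier (W.restrict ρ).carrier := by
  obtain ⟨e, he⟩ := h
  have hrel : balancedRelations k S' (U.restrict ρ).carrier (W.restrict ρ).carrier =
      balancedRelations k S U.carrier W.carrier := by
    refine congrArg (Submodule.span k) (Set.ext fun x => ⟨?_, ?_⟩)
    · rintro ⟨v, s, w, rfl⟩
      exact ⟨v, ρ s, w, rfl⟩
    · rintro ⟨v, s, w, rfl⟩
      refine ⟨v, ρ.symm s, w, ?_⟩
      change _ = MulOpposite.op (ρ (ρ.symm s)) • v ⊗ₜ[k] w - v ⊗ₜ[k] (ρ (ρ.symm s) • w)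
      rw [ρ.apply_symm_apply]
      rfl
  let E : BalancedTensor k S' (U.restrict ρ).carrier (W.restrict ρ).carrier ≃ₗ[k]
      BalancedTensor k S U.carrier W.carrier :=
    Submodule.quotEquivOfEq (R := k) (M := U.carrier ⊗[k] W.carrier) _ _ hrel
  refine ⟨(E.toAddEquiv.trans e).trans ρ.symm.toAddEquiv, fun s t v w => ?_⟩
  refine (congrArg ρ.symm (he (ρ s) (ρ t) v w)).trans ?_
  rw [map_mul, map_mul, ρ.symm_apply_apply, ρ.symm_apply_apply]
  rfl

theorem IsMoritaBimodule.isInvertibleBimodule_restrict_dual {V : Type u} [AddCommGroup V]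
    [Module k V] [Module S V] [Module Sᵐᵒᵖ V] [SMulCommClass S Sᵐᵒᵖ V] [IsScalarTower k S V]
    [IsScalarTower k Sᵐᵒᵖ V] [IsSemisimpleRing S] [Module.Finite S V] (h : IsMoritaBimodule S V)
    (ρ : S' ≃ₐ[k] S) : IsInvertibleBimodule k S' ((dualBimodule k S V).restrict ρ).carrier :=
  ⟨CentralBimodule.restrict ρ ⟨V⟩,
    BalancedTensorIsoRing.restrict (W := ⟨V⟩) ρ h.dual_balancedTensorIsoRing,
    BalancedTensorIsoRing.restrict (U := ⟨V⟩) ρ h.balancedTensorIsoRing_dual⟩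

end Restrict

/-! ### Regularity from invertibility -/

namespace BimoduleTensorAlgebra

section Converse

variable {k S V : Type u} [Field k] [Ring S] [Algebra k S]
  [AddCommGroup V] [Module k V] [Module S V] [Module Sᵐᵒᵖ V]
  [SMulCommClass S Sᵐᵒᵖ V] [IsScalarTower k S V] [IsScalarTower k Sᵐᵒᵖ V]
  (𝒱 : ℕ → Submodule k V) [DirectSum.Decomposition 𝒱] [IsGradedBimodule (S := S) 𝒱]
  [IsSemisimpleRing S] [Module.Finite k (grading S 𝒱 0)]

/-- If `V` satisfies the Morita criterion, then every `S`-linear map `V → J` is of the form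
`v ↦ v a`, so that the map `A → Hom_S(V, A) = Hom_S(V, S) ⊕ Hom_S(V, J)` has cokernel
`Hom_S(V, S)`. -/
theorem exists_extSA_one_equiv_dual [Module.Finite S V] (hV : IsMoritaBimodule S V)
    (ρ : S ≃ₐ[k] SemisimpleQuotient (grading S 𝒱))
    (hρ : ∀ a : BimoduleTensorAlgebra k S V,
      Ideal.Quotient.mk (gradedJacobson (grading S 𝒱)) a = ρ (augmentation k S V a)) :
    ∃ e : ExtSA (grading S 𝒱) 1 ≃+ ((dualBimodule k S V).restrict ρ.symm).carrier,
      (∀ s x, e (ExtSA.leftAct (grading S 𝒱) s x) = s • e x) ∧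
      (∀ x a, e (ExtSA.rightAct (grading S 𝒱) x a) =
        MulOpposite.op (Ideal.Quotient.mk (gradedJacobson (grading S 𝒱)) a) • e x) := by
  obtain ⟨Θ, hΘs, hΘ0, hΘr, hΘl⟩ := exists_extConnecting S 𝒱
  have hΘJ : ∀ h : leftHom k S V, (∀ v, h.1 v ∈ augIdeal k S V) → Θ h = 0 := fun h hh =>
    (hΘ0 h).2 (exists_eq_ofBimodule_mul hV.exists_endo_eq h hh)
  let Φ : (V →ₗ[S] S) →+ ExtSA (grading S 𝒱) 1 := Θ.comp
    (AddMonoidHom.mk' leftHom.ofForm fun f g => Subtype.ext (AddMonoidHom.ext fun v =>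
      map_add (ofRing k S V) (f v) (g v)))
  have hΦ : Function.Bijective Φ := by
    refine ⟨(injective_iff_map_eq_zero _).2 fun f hf => ?_, fun x => ?_⟩
    · obtain ⟨a, ha⟩ := (hΘ0 _).1 hf
      ext v
      have h1 := congrArg (augmentation k S V) (ha v)
      rwa [map_mul, augmentation_ofBimodule, zero_mul, AddMonoidHom.mk'_apply,
        leftHom.ofForm_apply, augmentation_ofRing] at h1
    · obtain ⟨h, rfl⟩ := hΘs x
      refine ⟨leftHom.toForm h, ?_⟩
      rw [eq_comm, ← sub_eq_zero]
      exact (map_sub Θ _ _).symm.trans (hΘJ _ (leftHom.sub_ofForm_toForm_mem h))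
  let E : (V →ₗ[S] S) ≃+ ExtSA (grading S 𝒱) 1 := AddEquiv.ofBijective Φ hΦ
  have hE : ∀ f, E f = Θ (leftHom.ofForm f) := fun f => rfl
  let D := (dualBimodule k S V).restrict ρ.symm
  let toMap : D.carrier ≃+ (V →ₗ[S] S) := AddEquiv.refl _
  refine ⟨E.symm.trans toMap.symm, fun s x => ?_, fun x a => ?_⟩
  · obtain ⟨f, rfl⟩ := E.surjective x
    rw [AddEquiv.trans_apply, AddEquiv.trans_apply, E.symm_apply_apply, AddEquiv.symm_apply_eq,
      AddEquiv.symm_apply_eq, hE, hE]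
    obtain ⟨s, rfl⟩ := ρ.surjective s
    have h1 : ρ s = Ideal.Quotient.mk _ (ofRing k S V s) := by rw [hρ, augmentation_ofRing]
    nth_rewrite 1 [h1]
    refine (hΘl _ _ s fun v => ?_).symm
    change ofRing k S V (f (MulOpposite.op (ρ.symm (ρ s)) • v)) = _
    rw [ρ.symm_apply_apply]
    rfl
  · obtain ⟨f, rfl⟩ := E.surjective x
    rw [AddEquiv.trans_apply, AddEquiv.trans_apply, E.symm_apply_apply, AddEquiv.symm_apply_eq,
      AddEquiv.symm_apply_eq, hE, hE, ← hΘr, ← sub_eq_zero, ← map_sub]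
    refine hΘJ _ fun v => ?_
    change ofRing k S V (f v) * a - ofRing k S V (f v * ρ.symm (Ideal.Quotient.mk _ a)) ∈ _
    rw [hρ, ρ.symm_apply_apply, map_mul, ← mul_sub]
    exact Ideal.mul_mem_left _ _ (sub_ofRing_augmentation_mem a)

theorem isGeneralizedASRegular_of_isInvertibleBimodule [Module.Finite S V] [Nontrivial V]
    (h : IsInvertibleBimodule k S V) : IsGeneralizedASRegular (grading S 𝒱) 1 := by
  obtain ⟨ρ, hρ⟩ := exists_quotient_equiv S 𝒱
  have hV : IsMoritaBimodule S V := h.isMoritaBimodule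
  obtain ⟨e, hel, her⟩ := exists_extSA_one_equiv_dual 𝒱 hV ρ hρ
  refine ⟨?_, fun i hi => ?_, _, hV.isInvertibleBimodule_restrict_dual ρ.symm, e, hel, her⟩
  · exact le_antisymm (gradedGlobalDim_le_one 𝒱)
      (Order.one_le_iff_ne_zero.2 (gradedGlobalDim_ne_zero 𝒱))
  · match i, hi with
    | 0, _ =>
      refine (subsingleton_extSA_zero_iff _).2 fun a ha => ?_
      exact eq_zero_of_forall_ofBimodule_mul_eq_zero h fun v =>
        ha _ (ofBimodule_mem_gradedJacobson 𝒱 v)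
    | i + 2, _ =>
      have := projective_gradedJacobson (S := S) 𝒱
      exact subsingleton_extSA_of_projective _ i

end Converse

end BimoduleTensorAlgebra

theorem mainTheorem9 (k S V : Type u) [Field k] [Ring S] [Algebra k S] [Module.Finite k S]
    [IsSemisimpleRing S] [AddCommGroup V] [Module k V] [Module S V] [Module Sᵐᵒᵖ V]
    [SMulCommClass S Sᵐᵒᵖ V] [IsScalarTower k S V] [IsScalarTower k Sᵐᵒᵖ V]
    [Module.Finite k V] [Nontrivial V]
    (𝒱 : ℕ → Submodule k V) [DirectSum.Decomposition 𝒱] [IsGradedBimodule (S := S) 𝒱]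
    (hfin : ∀ n : ℕ, Module.Finite k (BimoduleTensorAlgebra.grading S 𝒱 n)) :
    ∀ d : ℕ, IsGeneralizedASRegular (BimoduleTensorAlgebra.grading S 𝒱) d ↔
      IsInvertibleBimodule k S V ∧ d = 1 := by
  intro d
  have := hfin 0
  have : Module.Finite S V := Module.Finite.of_restrictScalars_finite k S V
  constructor
  · intro h
    have hle := BimoduleTensorAlgebra.gradedGlobalDim_le_one (S := S) 𝒱
    have hne := BimoduleTensorAlgebra.gradedGlobalDim_ne_zero (S := S) 𝒱
    rw [h.1] at hle hne
    have hd : d = 1 := le_antisymm (by exact_mod_cast hle)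
      (Nat.one_le_iff_ne_zero.2 (by exact_mod_cast hne))
    subst hd
    have hV := BimoduleTensorAlgebra.isMoritaBimodule_of_isGeneralizedASRegular 𝒱 h
    exact ⟨⟨dualBimodule k S V, hV.balancedTensorIsoRing_dual, hV.dual_balancedTensorIsoRing⟩, rfl⟩
  · rintro ⟨h, rfl⟩
    exact BimoduleTensorAlgebra.isGeneralizedASRegular_of_isInvertibleBimodule 𝒱 h
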